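/- Let $H$ be a real Hilbert space and let $\phi\in C^1(H)$ satisfy the quadratic lower bound: there are $\tau_*>0$ and $\phi_*\in\mathbb R$ with $\frac1{2\tau_*}|x|^2+\phi(x)\ge-\phi_*$ for every $x\in H$. **Notation.** $GF(\phi)$ is the set of curves $u\in C^1([0,\infty);H)$ with $u'(t)=-\nabla\phi(u(t))$ for every $t\ge0$. $TGF(\phi)$ is the set of truncated solutions: the elements of $GF(\phi)$ and the curves $t\mapsto \tilde v(\min\{t,T\})$ with $\tilde v\in GF(\phi)$ and $T\in[0,\infty)$. We write $\mathcal R(u)=u([0,\infty))$ and $T_\star(u)=\inf\{t\ge0: u(s)=u(t)\text{ for every }s\ge t\}\in[0,\infty]$ (with $\inf\emptyset=+\infty$). For $u,v\in GF(\phi)$ we say $u\succ v$ if $\mathcal R(v)\subset\overline{\mathcal R(u)}$ and there is an increasing (that is, non-decreasing) $1$-Lipschitz map $z:[0,\infty)\to[0,\infty)$ with $z(0)=0$ and $u(t)=v(z(t))$ for every $t\ge0$. A solution $u\in GF(\phi)$ is minimal if for every $v\in GF(\phi)$, $u\succ v$ implies $u=v$. **Theorem.** The relation $\succ$ is a partial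 order on $GF(\phi)$, and the following hold. 1. For every set $R\subset H$ which is the range of some $y\in GF(\phi)$ there exists a unique minimal solution $u$ with $R\subset\mathcal R(u)\subset\overline R$; moreover $v\succ u$ for every $v\in GF(\phi)$ with $R\subset\mathcal R(v)\subset\overline R$. In particular, for every $v\in GF(\phi)$ there exists a unique minimal solution $u$ with $v\succ u$. 2. A solution $u\in GF(\phi)$ is minimal if and only if for every $v\in TGF(\phi)$ with $v(0)=u(0)$ and $\mathcal R(v)\subset\overline{\mathcal R(u)}$ and all $t_0,t_1\ge0$: $u(t_0)=v(t_1)$ implies $\min\{t_0,T_\star(u)\}\le t_1$. 3. A solution $u\in GF(\phi)$ is minimal if and only if for every $v\in TGF(\phi)$ with $v(0)=u(0)$ and $\mathcal R(v)\subset\overline{\mathcal R(u)}$ we have $\phi(v(t))\ge\phi(u(t))$ for every $t\ge0$. 4. If $u$ is a minimal solution, $v\in TGF(\phi)$, $v(0)=u(0)$, $\mathcal R(v)\subset\mathcal R(u)$ and $\phi(v(t))\le\phi(u(t))$ for every $t\in[0,T_\star(v))$, then $v(t)=u(t)$ for every $t\in[0,T_\star(v))$. 5. A solution $u\in GF(\phi)$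 is minimal if and only if the set $\{t\in[0,T_\star(u)):\nabla\phi(u(t))=0\}$ is Lebesgue negligible. If $u$ is minimal and $T_\star(u)>0$, then $t\mapsto\phi(u(t))$ is strictly decreasing on $[0,T_\star(u))$ and $u$ is injective on $[0,T_\star(u))$. 6. A non-constant solution $u\in GF(\phi)$ is minimal if and only if there exists a locally absolutely continuous map $\psi:\big(\inf_{\mathcal R(u)}\phi,\ \phi(u(0))\big]\to[0,T_\star(u))$ (the infimum may be $-\infty$; locally absolutely continuous means absolutely continuous on every compact subinterval of the domain) such that $t=\psi(\phi(u(t)))$ for every $t\in[0,T_\star(u))$. -/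

import Mathlib

open Set Filter Topology MeasureTheory
open scoped NNReal ENNReal Gradient

noncomputable section

namespace GradientFlow

variable {H : Type*} [NormedAddCommGroup H] [InnerProductSpace ℝ H] [CompleteSpace H]

/-- The lower quadratic bound: `|x|² / (2 τ) + φ x ≥ -c` on `H` for some `τ > 0` and `c ∈ ℝ`. -/
def HasQuadraticLowerBound (φ : H → ℝ) : Prop :=
  ∃ τ : ℝ, 0 < τ ∧ ∃ c : ℝ, ∀ x : H, -c ≤ 1 / (2 * τ) * ‖x‖ ^ 2 + φ x

/-- `u : [0, ∞) → H` solves `u' = -∇φ(u)` on `[0, ∞)`, with the one-sided derivative at `0`.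
(For `φ` of class `C¹` the derivative `-∇φ(u)` is continuous, so `u` is automatically `C¹`.) -/
def IsSolution (φ : H → ℝ) (u : ℝ≥0 → H) : Prop :=
  ∀ t : ℝ≥0, HasDerivWithinAt (fun s : ℝ => u s.toNNReal) (-(∇ φ (u t))) (Ici 0) (t : ℝ)

/-- Truncated solutions: solutions, and curves `t ↦ w (t ∧ T)` with `w` a solution, `T ≥ 0`. -/
def IsTruncatedSolution (φ : H → ℝ) (v : ℝ≥0 → H) : Prop :=
  IsSolution φ v ∨
    ∃ w : ℝ≥0 → H, IsSolution φ w ∧ ∃ T : ℝ≥0, ∀ t : ℝ≥0, v t = w (min t T)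

/-- `T_⋆(u) ∈ [0, ∞]`: the infimum of the times after which `u` is constant. -/
def Tstar (u : ℝ≥0 → H) : ℝ≥0∞ :=
  sInf ((fun t : ℝ≥0 => (t : ℝ≥0∞)) '' {t : ℝ≥0 | ∀ s, t ≤ s → u s = u t})

/-- The relation `u ≻ v`: `range v ⊆ closure (range u)` and `u = v ∘ z` for an increasing
`1`-Lipschitz map `z : [0, ∞) → [0, ∞)` with `z 0 = 0`. -/
def Succ (u v : ℝ≥0 → H) : Prop :=
  range v ⊆ closure (range u) ∧
    ∃ z : ℝ≥0 → ℝ≥0, z 0 = 0 ∧ Monotone z ∧ LipschitzWith 1 z ∧ ∀ t, u t = v (z t)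

/-- Minimal solutions. -/
def IsMinimal (φ : H → ℝ) (u : ℝ≥0 → H) : Prop :=
  IsSolution φ u ∧ ∀ v : ℝ≥0 → H, IsSolution φ v → Succ u v → u = v

/-- The interval `(inf_{range u} φ, φ (u 0)]` of `ℝ`; the infimum is taken in `[-∞, ∞]`. -/
def energyInterval (φ : H → ℝ) (u : ℝ≥0 → H) : Set ℝ :=
  {r : ℝ | (⨅ t : ℝ≥0, ((φ (u t) : ℝ) : EReal)) < (r : EReal) ∧ r ≤ φ (u 0)}

/-- `f` is absolutely continuous on every compact interval contained in `I`. -/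
def LocallyAbsolutelyContinuousOn (f : ℝ → ℝ) (I : Set ℝ) : Prop :=
  ∀ a b : ℝ, a ≤ b → Icc a b ⊆ I → AbsolutelyContinuousOnInterval f a b

end GradientFlow

end

noncomputable section

namespace GradientFlow

variable {H : Type*} [NormedAddCommGroup H] [InnerProductSpace ℝ H] [CompleteSpace H]

/-! ### Energy estimates for curves with right derivative `-∇φ`. -/

section Flow

variable {φ : H → ℝ}

/-! Along a solution the energy has derivative `-‖∇φ‖²`, so a solution can revisit an energy level
only by resting at one critical point. What distinguishes solutions with the same trace is the time
wasted at critical points. Let `activeTime` measure the time spent off them.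

Two facts carry the theorem. First, a solution `y` is a function of its active time, `y = w ∘
activeTime φ y`, and `w` can be chosen to be a solution (`IsSolution.exists_reduction`). If the
total active time is finite, `w` must be continued by a rest point: the quadratic lower bound gives,
through Grönwall, a lower bound on the energy, hence a limit of `y`, which is critical. Second,
active time is determined by the trace: substituting `r = φ(u(s))` turns it into an integral of `1 /
‖∇φ‖²` over the energies of the active points (`IsSolution.activeTime_le_of_image_subset`).

Consequently minimal solutions are exactly those whose active time equals the time until they stop
(`isMinimal_iff_isRegular`), and the reduction `w` is the minimal solution below `y`. The
order-theoretic and variational characterizations come from comparing active times, testing against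
the reduction for the converses. For the last one, time as a function of the energy is the integral
of the density of the image under the energy of Lebesgue measure on the active set. Conversely,
absolute continuity of that function prevents the energies of critical times, a null set by a
one-dimensional Sard argument, from accounting for any elapsed time. -/

lemma continuous_gradient (hφ : ContDiff ℝ 1 φ) : Continuous (∇ φ) :=
  (InnerProductSpace.toDual ℝ H).symm.continuous.comp (hφ.continuous_fderiv one_ne_zero)

lemma hasGradientAt_gradient (hφ : ContDiff ℝ 1 φ) (x : H) : HasGradientAt φ (∇ φ x) x :=
  (hφ.differentiable one_ne_zero x).hasGradientAt

lemma hasDerivWithinAt_energy (hφ : ContDiff ℝ 1 φ) {f : ℝ → H} {s : Set ℝ} {t : ℝ}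
    (hf : HasDerivWithinAt f (-(∇ φ (f t))) s t) :
    HasDerivWithinAt (fun r => φ (f r)) (-‖∇ φ (f t)‖ ^ 2) s t := by
  have h := (hasGradientAt_gradient hφ (f t)).hasFDerivAt.comp_hasDerivWithinAt t hf
  convert! h using 1
  rw [InnerProductSpace.toDual_apply_apply, inner_neg_right, real_inner_self_eq_norm_sq]

/-- A curve with right derivative `-∇φ` on `[a, b)`. -/
structure IsFlowOn (φ : H → ℝ) (f : ℝ → H) (a b : ℝ) : Prop where
  continuousOn : ContinuousOn f (Icc a b)
  hasDeriv : ∀ t ∈ Ico a b, HasDerivWithinAt f (-(∇ φ (f t))) (Ici t) t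

lemma IsFlowOn.mono {f : ℝ → H} {a b c d : ℝ} (h : IsFlowOn φ f a b) (hac : a ≤ c) (hdb : d ≤ b) :
    IsFlowOn φ f c d :=
  ⟨h.continuousOn.mono (Icc_subset_Icc hac hdb), fun t ht => h.hasDeriv t ⟨hac.trans ht.1,
    ht.2.trans_le hdb⟩⟩

/-- Integrates `‖∇φ‖ ≤ δ + ‖∇φ‖² / δ`. The parameter stays free: `δ → 0` handles constant energy,
while `δ = 1` suffices for convergence. -/
lemma IsFlowOn.norm_sub_le (hφ : ContDiff ℝ 1 φ) {f : ℝ → H} {a b : ℝ} (h : IsFlowOn φ f a b)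
    (hab : a ≤ b) {δ : ℝ} (hδ : 0 < δ) :
    ‖f b - f a‖ ≤ δ * (b - a) + (φ (f a) - φ (f b)) / δ := by
  have key := image_norm_le_of_norm_deriv_right_le_deriv_boundary' (f := fun t => f t - f a)
    (f' := fun t => -(∇ φ (f t))) (a := a) (b := b)
    (B := fun t => δ * (t - a) + (φ (f a) - φ (f t)) / δ)
    (B' := fun t => δ * 1 + (0 - -‖∇ φ (f t)‖ ^ 2) / δ)
    (h.continuousOn.sub continuousOn_const)
    (fun x hx => (h.hasDeriv x hx).sub_const _) (by simp)
    (((continuousOn_id.sub continuousOn_const).const_mul δ).add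
      ((continuousOn_const.sub (hφ.continuous.comp_continuousOn h.continuousOn)).div_const δ))
    (fun x hx => by
      have h1 := hasDerivWithinAt_energy hφ (h.hasDeriv x hx)
      have h2 : HasDerivWithinAt (fun t => t - a) 1 (Ici x) x :=
        (hasDerivWithinAt_id x _).sub_const a
      exact (h2.const_mul δ).add
        (((hasDerivWithinAt_const x _ (φ (f a))).sub h1).div_const δ))
    (fun x _ => by
      rw [norm_neg]
      have : (0 - -‖∇ φ (f x)‖ ^ 2) / δ = ‖∇ φ (f x)‖ ^ 2 / δ := by ring
      rw [this, mul_one, ← sub_le_iff_le_add', le_div_iff₀ hδ]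
      nlinarith [sq_nonneg (‖∇ φ (f x)‖ - δ), norm_nonneg (∇ φ (f x))])
  exact key (right_mem_Icc.2 hab)

lemma IsFlowOn.energy_le (hφ : ContDiff ℝ 1 φ) {f : ℝ → H} {a b : ℝ} (h : IsFlowOn φ f a b)
    (hab : a ≤ b) : φ (f b) ≤ φ (f a) :=
  image_le_of_deriv_right_le_deriv_boundary (f := fun t => φ (f t))
    (f' := fun t => -‖∇ φ (f t)‖ ^ 2) (B := fun _ => φ (f a)) (B' := fun _ => 0)
    (hφ.continuous.comp_continuousOn h.continuousOn)
    (fun x hx => hasDerivWithinAt_energy hφ (h.hasDeriv x hx)) le_rfl continuousOn_const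
    (fun x _ => hasDerivWithinAt_const x _ _)
    (fun x _ => by nlinarith [sq_nonneg ‖∇ φ (f x)‖]) (right_mem_Icc.2 hab)

/-- Grönwall estimate for the energy augmented by a multiple of the squared norm. -/
lemma IsFlowOn.augmentedEnergy_le (hφ : ContDiff ℝ 1 φ) {τ c : ℝ} (hτ : 0 < τ)
    (hlb : ∀ x : H, -c ≤ 1 / (2 * τ) * ‖x‖ ^ 2 + φ x)
    {f : ℝ → H} {a b : ℝ} (h : IsFlowOn φ f a b) (hab : a ≤ b) :
    φ (f b) + c + ‖f b‖ ^ 2 / τ ≤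
      (φ (f a) + c + ‖f a‖ ^ 2 / τ) * Real.exp (2 / τ * (b - a)) := by
  have key := image_le_of_deriv_right_le_deriv_boundary
    (f := fun t => (φ (f t) + c + ‖f t‖ ^ 2 / τ) * Real.exp (-(2 / τ * (t - a))))
    (f' := fun t => (-‖∇ φ (f t)‖ ^ 2 + 2 * inner ℝ (f t) (-(∇ φ (f t))) / τ) *
      Real.exp (-(2 / τ * (t - a))) + (φ (f t) + c + ‖f t‖ ^ 2 / τ) *
      (Real.exp (-(2 / τ * (t - a))) * -(2 / τ * 1)))
    (a := a) (b := b)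
    (B := fun _ => φ (f a) + c + ‖f a‖ ^ 2 / τ) (B' := fun _ => 0)
    ((((hφ.continuous.comp_continuousOn h.continuousOn).add continuousOn_const).add
      ((h.continuousOn.norm.pow 2).div_const τ)).mul
      (((continuousOn_id.sub continuousOn_const).const_mul (2 / τ)).neg.rexp))
    (fun x hx => by
      have h1 := hasDerivWithinAt_energy hφ (h.hasDeriv x hx)
      have h2 : HasDerivWithinAt (fun t => t - a) 1 (Ici x) x :=
        (hasDerivWithinAt_id x _).sub_const a
      exact ((h1.add_const c).add ((h.hasDeriv x hx).norm_sq.div_const τ)).mul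
        ((h2.const_mul (2 / τ)).neg.exp))
    (by simp) continuousOn_const (fun x _ => hasDerivWithinAt_const x _ _)
    (fun x _ => by
      -- Completing the square in `τ ∇φ + f x`.
      have hc : -(‖∇ φ (f x)‖ ^ 2) - 2 * inner ℝ (f x) (∇ φ (f x)) / τ ≤ ‖f x‖ ^ 2 / τ ^ 2 := by
        have := sq_nonneg ‖τ • ∇ φ (f x) + f x‖
        rw [norm_add_sq_real, norm_smul, inner_smul_left, Real.norm_of_nonneg hτ.le,
          real_inner_comm] at this
        simp only [conj_trivial] at this
        rw [le_div_iff₀ (by positivity)]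
        have e : (-(‖∇ φ (f x)‖ ^ 2) - 2 * inner ℝ (f x) (∇ φ (f x)) / τ) * τ ^ 2 =
          -(τ * ‖∇ φ (f x)‖) ^ 2 - 2 * (τ * inner ℝ (f x) (∇ φ (f x))) := by
          field_simp
        rw [e]
        linarith
      -- The augmentation is twice the quadratic term of the lower bound: one half makes `φ + c`
      -- nonnegative, the other remains to dominate the left side.
      have hb : ‖f x‖ ^ 2 / τ ^ 2 ≤ 2 / τ * (φ (f x) + c + ‖f x‖ ^ 2 / τ) := by
        have h1 : 0 ≤ 2 / τ * (1 / (2 * τ) * ‖f x‖ ^ 2 + φ (f x) + c) :=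
          mul_nonneg (by positivity) (by linarith [hlb (f x)])
        have h2 : 2 / τ * (φ (f x) + c + ‖f x‖ ^ 2 / τ) =
          2 / τ * (1 / (2 * τ) * ‖f x‖ ^ 2 + φ (f x) + c) + ‖f x‖ ^ 2 / τ ^ 2 := by
          field_simp; ring
        linarith
      have he := Real.exp_pos (-(2 / τ * (x - a)))
      rw [inner_neg_right]
      have : -‖∇ φ (f x)‖ ^ 2 + 2 * -inner ℝ (f x) (∇ φ (f x)) / τ -
        2 / τ * (φ (f x) + c + ‖f x‖ ^ 2 / τ) ≤ 0 := by
        have e : 2 * -inner ℝ (f x) (∇ φ (f x)) / τ = -(2 * inner ℝ (f x) (∇ φ (f x)) / τ) := by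
          ring
        rw [e]; linarith
      have := mul_nonpos_of_nonpos_of_nonneg this he.le
      linarith) (right_mem_Icc.2 hab)
  simp only [Real.exp_neg] at key
  rwa [← div_eq_mul_inv, div_le_iff₀ (Real.exp_pos _)] at key

end Flow

/-! ### Rigidity of solutions at constant energy. -/

section Solution

variable {φ : H → ℝ} {u v : ℝ≥0 → H}

lemma IsSolution.continuous (hu : IsSolution φ u) : Continuous u := by
  have h : ContinuousOn (fun s : ℝ => u s.toNNReal) (Ici 0) := fun t ht => by
    have := (hu ⟨t, ht⟩).continuousWithinAt
    exact this
  have h2 := h.comp_continuous NNReal.continuous_coe (fun t => t.2)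
  simpa [Function.comp_def] using h2

lemma IsSolution.isFlowOn (hu : IsSolution φ u) {a : ℝ} (ha : 0 ≤ a) (b : ℝ) :
    IsFlowOn φ (fun s : ℝ => u s.toNNReal) a b where
  continuousOn := (hu.continuous.comp continuous_real_toNNReal).continuousOn
  hasDeriv t ht := by
    have := hu ⟨t, ha.trans ht.1⟩
    have e : (⟨t, ha.trans ht.1⟩ : ℝ≥0) = t.toNNReal := by
      ext; simp [ha.trans ht.1]
    rw [e] at this
    simp only [Real.coe_toNNReal t (ha.trans ht.1)] at this
    exact this.mono (Ici_subset_Ici.2 (ha.trans ht.1))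

lemma IsSolution.norm_sub_le (hφ : ContDiff ℝ 1 φ) (hu : IsSolution φ u) {s t : ℝ≥0} (hst : s ≤ t)
    {δ : ℝ} (hδ : 0 < δ) :
    ‖u t - u s‖ ≤ δ * (t - s) + (φ (u s) - φ (u t)) / δ := by
  simpa using (hu.isFlowOn s.2 t).norm_sub_le hφ (NNReal.coe_le_coe.2 hst) hδ

lemma IsSolution.antitone_energy (hφ : ContDiff ℝ 1 φ) (hu : IsSolution φ u) :
    Antitone fun t => φ (u t) := fun s t hst => by
  simpa using (hu.isFlowOn s.2 t).energy_le hφ (NNReal.coe_le_coe.2 hst)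

lemma IsSolution.eq_of_energy_le (hφ : ContDiff ℝ 1 φ) (hu : IsSolution φ u) {s t : ℝ≥0}
    (hst : s ≤ t) (h : φ (u s) ≤ φ (u t)) : u t = u s := by
  have h0 : φ (u s) - φ (u t) ≤ 0 := by linarith
  have h1 : ∀ ε > (0 : ℝ), ‖u t - u s‖ ≤ 0 + ε := fun ε hε => by
    have hp : (0 : ℝ) < t - s + 1 := by
      have : (s : ℝ) ≤ t := hst
      linarith
    have h2 := hu.norm_sub_le hφ hst (div_pos hε hp)
    have h3 : (φ (u s) - φ (u t)) / (ε / (t - s + 1)) ≤ 0 :=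
      div_nonpos_of_nonpos_of_nonneg h0 (by positivity)
    have h4 : ε / (t - s + 1) * (t - s) ≤ ε := by
      rw [div_mul_eq_mul_div, div_le_iff₀ hp]; nlinarith
    linarith
  have := le_of_forall_pos_le_add h1
  exact sub_eq_zero.1 (norm_le_zero_iff.1 this)

lemma IsSolution.eq_of_energy_eq (hφ : ContDiff ℝ 1 φ) (hu : IsSolution φ u) {s t : ℝ≥0}
    (h : φ (u s) = φ (u t)) : u s = u t := by
  rcases le_total s t with hst | hst
  · exact (hu.eq_of_energy_le hφ hst h.le).symm
  · exact hu.eq_of_energy_le hφ hst h.ge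

lemma IsSolution.eq_of_mem_Icc (hφ : ContDiff ℝ 1 φ) (hu : IsSolution φ u) {s r t : ℝ≥0}
    (hsr : s ≤ r) (hrt : r ≤ t) (h : u s = u t) : u r = u s :=
  hu.eq_of_energy_le hφ hsr (h ▸ hu.antitone_energy hφ hrt)

/-- Monotonicity of the energy makes `u` constant on all of `[s, t]`, so its right derivative at `s`
vanishes. -/
lemma IsSolution.gradient_eq_zero (hφ : ContDiff ℝ 1 φ) (hu : IsSolution φ u) {s t : ℝ≥0}
    (hst : s < t) (h : u s = u t) : ∇ φ (u s) = 0 := by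
  have h1 := (hu.isFlowOn s.2 t).hasDeriv s ⟨le_rfl, hst⟩
  have h2 : HasDerivWithinAt (fun r : ℝ => u r.toNNReal) 0 (Ici (s : ℝ)) s := by
    refine (hasDerivWithinAt_const (s : ℝ) _ (u s)).congr_of_eventuallyEq ?_ (by simp)
    filter_upwards [Ico_mem_nhdsGE (NNReal.coe_lt_coe.2 hst)] with r hr
    refine hu.eq_of_mem_Icc hφ (NNReal.le_toNNReal_of_coe_le hr.1) ?_ h
    exact Real.toNNReal_le_iff_le_coe.2 hr.2.le
  have := (uniqueDiffWithinAt_Ici _).eq_deriv _ h1 h2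
  simpa using this

lemma IsSolution.continuous_energy (hφ : ContDiff ℝ 1 φ) (hu : IsSolution φ u) :
    Continuous fun t => φ (u t) := hφ.continuous.comp hu.continuous

end Solution

/-! ### Active time. -/

section ActiveTime

variable {φ : H → ℝ} {u v : ℝ≥0 → H}

/-- The times at which `u` is not at a critical point of `φ`. -/
def activeSet (φ : H → ℝ) (u : ℝ≥0 → H) : Set ℝ := {s | ∇ φ (u s.toNNReal) ≠ 0}

/-- The time that `u` spends off the critical points of `φ` up to time `t`. -/
def activeTime (φ : H → ℝ) (u : ℝ≥0 → H) (t : ℝ≥0) : ℝ≥0 :=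
  (volume (activeSet φ u ∩ Icc 0 (t : ℝ))).toNNReal

lemma isOpen_activeSet (hφ : ContDiff ℝ 1 φ) (hu : IsSolution φ u) : IsOpen (activeSet φ u) :=
  isOpen_ne_fun ((continuous_gradient hφ).comp (hu.continuous.comp continuous_real_toNNReal))
    continuous_const

lemma coe_activeTime (φ : H → ℝ) (u : ℝ≥0 → H) (t : ℝ≥0) :
    (activeTime φ u t : ℝ≥0∞) = volume (activeSet φ u ∩ Icc 0 (t : ℝ)) :=
  ENNReal.coe_toNNReal (measure_ne_top_of_subset inter_subset_right (by simp))

lemma activeTime_zero (φ : H → ℝ) (u : ℝ≥0 → H) : activeTime φ u 0 = 0 := by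
  have : volume (activeSet φ u ∩ Icc 0 ((0 : ℝ≥0) : ℝ)) = 0 :=
    measure_mono_null inter_subset_right (by simp)
  rw [activeTime, this, ENNReal.toNNReal_zero]

lemma activeTime_le (φ : H → ℝ) (u : ℝ≥0 → H) (t : ℝ≥0) : activeTime φ u t ≤ t := by
  rw [← ENNReal.coe_le_coe, coe_activeTime]
  refine (measure_mono inter_subset_right).trans ?_
  simp [Real.volume_Icc]

lemma activeTime_eq_add (φ : H → ℝ) (u : ℝ≥0 → H) {s t : ℝ≥0} (hst : s ≤ t) :
    (activeTime φ u t : ℝ≥0∞) =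
      activeTime φ u s + volume (activeSet φ u ∩ Ioc (s : ℝ) t) := by
  rw [coe_activeTime, coe_activeTime,
    ← measure_inter_add_sdiff (activeSet φ u ∩ Icc 0 (t : ℝ)) (measurableSet_Iic (a := (s : ℝ)))]
  have hst' : (s : ℝ) ≤ t := hst
  congr 2
  · ext x; simp only [mem_inter_iff, mem_Icc, mem_Iic]; grind
  · have := NNReal.coe_nonneg s
    ext x; simp only [mem_inter_iff, mem_Icc, Set.mem_sdiff, mem_Iic, mem_Ioc]; grind

lemma monotone_activeTime (φ : H → ℝ) (u : ℝ≥0 → H) : Monotone (activeTime φ u) := fun s t hst => by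
  rw [← ENNReal.coe_le_coe, activeTime_eq_add φ u hst]
  exact le_self_add

lemma coe_activeTime_sub (φ : H → ℝ) (u : ℝ≥0 → H) {s t : ℝ≥0} (hst : s ≤ t) :
    (activeTime φ u t : ℝ) - activeTime φ u s = volume.real (activeSet φ u ∩ Ioc (s : ℝ) t) := by
  have h := congrArg ENNReal.toReal (activeTime_eq_add φ u hst)
  rw [ENNReal.toReal_add ENNReal.coe_ne_top
    (measure_ne_top_of_subset inter_subset_right (by simp))] at h
  simp only [ENNReal.coe_toReal] at h
  rw [h, measureReal_def]; ring

lemma coe_activeTime_sub_le (φ : H → ℝ) (u : ℝ≥0 → H) {s t : ℝ≥0} (hst : s ≤ t) :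
    (activeTime φ u t : ℝ) - activeTime φ u s ≤ t - s := by
  rw [coe_activeTime_sub φ u hst]
  refine (measureReal_mono inter_subset_right (by simp)).trans ?_
  simp [Real.volume_real_Ioc, NNReal.coe_le_coe.2 hst]

lemma lipschitzWith_activeTime (φ : H → ℝ) (u : ℝ≥0 → H) : LipschitzWith 1 (activeTime φ u) := by
  refine LipschitzWith.of_dist_le_mul fun s t => ?_
  rw [NNReal.dist_eq, NNReal.dist_eq, NNReal.coe_one, one_mul]
  rcases le_total s t with hst | hst
  · rw [abs_sub_comm, abs_sub_comm (s : ℝ),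
      abs_of_nonneg (sub_nonneg.2 (NNReal.coe_le_coe.2 (monotone_activeTime φ u hst))),
      abs_of_nonneg (sub_nonneg.2 (NNReal.coe_le_coe.2 hst))]
    exact coe_activeTime_sub_le φ u hst
  · rw [abs_of_nonneg (sub_nonneg.2 (NNReal.coe_le_coe.2 (monotone_activeTime φ u hst))),
      abs_of_nonneg (sub_nonneg.2 (NNReal.coe_le_coe.2 hst))]
    exact coe_activeTime_sub_le φ u hst

lemma continuous_activeTime (φ : H → ℝ) (u : ℝ≥0 → H) : Continuous (activeTime φ u) :=
  (lipschitzWith_activeTime φ u).continuous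

/-- Increments of a solution, measured against its active time. -/
lemma IsSolution.norm_sub_add_activeTime_smul_le (hφ : ContDiff ℝ 1 φ) (hu : IsSolution φ u)
    {s t : ℝ≥0} (hst : s ≤ t) {g : H} {ε : ℝ}
    (hg : ∀ r, s ≤ r → r ≤ t → ‖∇ φ (u r) - g‖ ≤ ε) :
    ‖u t - u s + ((activeTime φ u t : ℝ) - activeTime φ u s) • g‖ ≤
      ε * ((activeTime φ u t : ℝ) - activeTime φ u s) := by
  have hst' : (s : ℝ) ≤ t := hst
  have hfl := hu.isFlowOn s.2 t
  have hcont : Continuous fun r : ℝ => ∇ φ (u r.toNNReal) :=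
    (continuous_gradient hφ).comp (hu.continuous.comp continuous_real_toNNReal)
  set A := activeSet φ u ∩ Ioc (s : ℝ) t
  have hA : MeasurableSet A := (isOpen_activeSet hφ hu).measurableSet.inter measurableSet_Ioc
  have hfin : volume A < ⊤ := (measure_mono inter_subset_right).trans_lt (by simp)
  -- Off the active set the integrand of the fundamental theorem of calculus vanishes.
  have h1 : u t - u s = ∫ r in A, -(∇ φ (u r.toNNReal)) := by
    have := intervalIntegral.integral_eq_sub_of_hasDeriv_right_of_le hst' hfl.continuousOn
      (fun x hx => (hfl.hasDeriv x ⟨hx.1.le, hx.2⟩).mono Ioi_subset_Ici_self)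
      (hcont.neg.intervalIntegrable _ _)
    simp only [Real.toNNReal_coe] at this
    rw [← this, intervalIntegral.integral_of_le hst']
    refine setIntegral_eq_of_subset_of_forall_sdiff_eq_zero measurableSet_Ioc inter_subset_right ?_
    intro x hx
    have : x ∉ activeSet φ u := fun h => hx.2 ⟨h, hx.1⟩
    simpa [activeSet] using this
  have hint : IntegrableOn (fun r : ℝ => -(∇ φ (u r.toNNReal))) A :=
    (hcont.neg.integrableOn_Icc (a := (s : ℝ)) (b := t)).mono_set
      (inter_subset_right.trans Ioc_subset_Icc_self)
  rw [coe_activeTime_sub φ u hst, ← setIntegral_const, h1, ← integral_add hint (by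
    exact integrableOn_const hfin.ne)]
  refine norm_setIntegral_le_of_norm_le_const hfin fun r hr => ?_
  rw [neg_add_eq_sub, norm_sub_rev]
  exact hg _ (NNReal.le_toNNReal_of_coe_le hr.2.1.le) (Real.toNNReal_le_iff_le_coe.2 hr.2.2)

lemma IsSolution.exists_bound_gradient (hφ : ContDiff ℝ 1 φ) (hu : IsSolution φ u) (T : ℝ≥0) :
    ∃ M : ℝ, 0 ≤ M ∧ ∀ r ≤ T, ‖∇ φ (u r)‖ ≤ M := by
  obtain ⟨M, hM⟩ := (isCompact_Icc (a := (0 : ℝ≥0)) (b := T)).exists_bound_of_continuousOn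
    ((continuous_gradient hφ).comp hu.continuous).continuousOn
  exact ⟨M, (norm_nonneg _).trans (hM 0 ⟨le_rfl, zero_le⟩), fun r hr => hM r ⟨zero_le, hr⟩⟩

lemma IsSolution.eq_of_activeTime_eq (hφ : ContDiff ℝ 1 φ) (hu : IsSolution φ u) {s t : ℝ≥0}
    (h : activeTime φ u s = activeTime φ u t) : u s = u t := by
  wlog hst : s ≤ t generalizing s t
  · exact (this h.symm (le_of_not_ge hst)).symm
  obtain ⟨M, -, hM⟩ := hu.exists_bound_gradient hφ t
  have := hu.norm_sub_add_activeTime_smul_le hφ hst (g := 0) (ε := M)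
    (fun r _ hr => by simpa using hM r hr)
  rw [h] at this
  simpa [sub_eq_zero, eq_comm] using this

end ActiveTime

/-! ### Reparametrization by active time. -/

section Reduction

variable {φ : H → ℝ} {u v w y : ℝ≥0 → H}

lemma hasDerivWithinAt_toNNReal_of_forall {E : Type*} [NormedAddCommGroup E] [NormedSpace ℝ E]
    {w : ℝ≥0 → E} {g : E} {τ : ℝ≥0}
    (h : ∀ ε > (0 : ℝ), ∃ δ > (0 : ℝ), ∀ σ : ℝ≥0, |(σ : ℝ) - τ| < δ →
      ‖w σ - w τ + ((σ : ℝ) - τ) • g‖ ≤ ε * |(σ : ℝ) - τ|) :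
    HasDerivWithinAt (fun s : ℝ => w s.toNNReal) (-g) (Ici 0) τ := by
  rw [hasDerivWithinAt_iff_isLittleO, Asymptotics.isLittleO_iff]
  intro ε hε
  obtain ⟨δ, hδ, H⟩ := h ε hε
  filter_upwards [self_mem_nhdsWithin, mem_nhdsWithin_of_mem_nhds (Metric.ball_mem_nhds (τ : ℝ) hδ)]
    with s hs hs'
  have := H s.toNNReal (by simpa [Real.coe_toNNReal s hs, Real.dist_eq] using hs')
  rw [Real.coe_toNNReal s hs] at this
  simpa using this

lemma exists_activeTime_eq (φ : H → ℝ) (y : ℝ≥0 → H) {σ T : ℝ≥0} (h : σ ≤ activeTime φ y T) :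
    ∃ t ≤ T, activeTime φ y t = σ := by
  obtain ⟨t, ht, e⟩ := intermediate_value_Icc (zero_le (a := T))
    (continuous_activeTime φ y).continuousOn ⟨by rw [activeTime_zero]; exact zero_le, h⟩
  exact ⟨t, ht.2, e⟩

lemma IsSolution.norm_sub_le_activeTime (hφ : ContDiff ℝ 1 φ) (hy : IsSolution φ y) {T : ℝ≥0}
    {M : ℝ} (hM : ∀ r ≤ T, ‖∇ φ (y r)‖ ≤ M) {s t : ℝ≥0} (hs : s ≤ T) (ht : t ≤ T) :
    ‖y t - y s‖ ≤ M * |(activeTime φ y t : ℝ) - activeTime φ y s| := by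
  wlog hst : s ≤ t generalizing s t
  · rw [norm_sub_rev, abs_sub_comm]
    exact this ht hs (le_of_not_ge hst)
  have := hy.norm_sub_add_activeTime_smul_le hφ hst (g := 0) (ε := M)
    (fun r _ hr => by simpa using hM r (hr.trans ht))
  rw [abs_of_nonneg (sub_nonneg.2 (NNReal.coe_le_coe.2 (monotone_activeTime φ y hst)))]
  simpa using this

/-- Differentiability of a curve `w` with `y = w ∘ activeTime`, on the part reached by `y` up to a
given time. -/
lemma IsSolution.reparam_estimate (hφ : ContDiff ℝ 1 φ) (hy : IsSolution φ y)
    (hw : ∀ t, y t = w (activeTime φ y t)) {t₀ T : ℝ≥0} (hT : t₀ ≤ T) {ε : ℝ} (hε : 0 < ε) :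
    ∃ δ > (0 : ℝ), ∀ σ ≤ activeTime φ y T, |(σ : ℝ) - activeTime φ y t₀| < δ →
      ‖w σ - w (activeTime φ y t₀) + ((σ : ℝ) - activeTime φ y t₀) • ∇ φ (w (activeTime φ y t₀))‖ ≤
        ε * |(σ : ℝ) - activeTime φ y t₀| := by
  obtain ⟨M, hM0, hM⟩ := hy.exists_bound_gradient hφ T
  obtain ⟨ρ, hρ, hball⟩ := Metric.continuousAt_iff.1
    ((continuous_gradient hφ).continuousAt (x := y t₀)) ε hε
  -- In active time `y` is `M`-Lipschitz up to `T`, so this radius keeps it within `ρ` of `y t₀`;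
  -- the `+ 1` covers `M = 0`.
  refine ⟨ρ / (M + 1), by positivity, fun σ hσ hσ' => ?_⟩
  obtain ⟨t, htT, rfl⟩ := exists_activeTime_eq φ y hσ
  rw [← hw, ← hw]
  have close : ∀ r ≤ T, |(activeTime φ y r : ℝ) - activeTime φ y t₀| ≤
      |(activeTime φ y t : ℝ) - activeTime φ y t₀| → ‖∇ φ (y r) - ∇ φ (y t₀)‖ ≤ ε := fun r hr hr' => by
    rw [← dist_eq_norm]
    refine (hball ?_).le
    rw [dist_eq_norm]
    have h2 := hr'.trans_lt hσ'
    rw [lt_div_iff₀ (by positivity)] at h2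
    have h1 := hy.norm_sub_le_activeTime hφ hM hT hr
    nlinarith [abs_nonneg ((activeTime φ y r : ℝ) - activeTime φ y t₀)]
  rcases le_total t₀ t with h | h
  · have m := monotone_activeTime φ y
    have := hy.norm_sub_add_activeTime_smul_le hφ h (g := ∇ φ (y t₀)) (ε := ε)
      (fun r hr hr' => close r (hr'.trans htT) (by
        have h1 := NNReal.coe_le_coe.2 (m hr)
        have h2 := NNReal.coe_le_coe.2 (m hr')
        rw [abs_of_nonneg (by linarith), abs_of_nonneg (by linarith)]
        linarith))
    rwa [abs_of_nonneg (sub_nonneg.2 (NNReal.coe_le_coe.2 (m h)))]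
  · have m := monotone_activeTime φ y
    have := hy.norm_sub_add_activeTime_smul_le hφ h (g := ∇ φ (y t₀)) (ε := ε)
      (fun r hr hr' => close r (hr'.trans hT) (by
        have h1 := NNReal.coe_le_coe.2 (m hr)
        have h2 := NNReal.coe_le_coe.2 (m hr')
        rw [abs_sub_comm, abs_of_nonneg (by linarith), abs_sub_comm, abs_of_nonneg (by linarith)]
        linarith))
    rw [abs_sub_comm, abs_of_nonneg (sub_nonneg.2 (NNReal.coe_le_coe.2 (m h))), ← norm_neg]
    refine le_trans (le_of_eq (congrArg _ ?_)) this
    module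

lemma IsSolution.hasDerivWithinAt_reparam (hφ : ContDiff ℝ 1 φ) (hy : IsSolution φ y)
    (hw : ∀ t, y t = w (activeTime φ y t)) {τ t₁ : ℝ≥0} (h : τ < activeTime φ y t₁) :
    HasDerivWithinAt (fun s : ℝ => w s.toNNReal) (-(∇ φ (w τ))) (Ici 0) τ := by
  refine hasDerivWithinAt_toNNReal_of_forall fun ε hε => ?_
  obtain ⟨t₀, ht₀, rfl⟩ := exists_activeTime_eq φ y h.le
  obtain ⟨δ, hδ, hδ'⟩ := hy.reparam_estimate hφ hw ht₀ hε
  refine ⟨min δ ((activeTime φ y t₁ : ℝ) - activeTime φ y t₀),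
    lt_min hδ (sub_pos.2 (NNReal.coe_lt_coe.2 h)), fun σ hσ => ?_⟩
  refine hδ' σ ?_ (hσ.trans_le (min_le_left _ _))
  have := (le_abs_self _).trans_lt (hσ.trans_le (min_le_right _ _))
  exact NNReal.coe_le_coe.1 (by linarith)

lemma IsSolution.isFlowOn_reparam (hφ : ContDiff ℝ 1 φ) (hy : IsSolution φ y)
    (hw : ∀ t, y t = w (activeTime φ y t)) (T : ℝ≥0) :
    IsFlowOn φ (fun s : ℝ => w s.toNNReal) 0 (activeTime φ y T) where
  continuousOn := by
    obtain ⟨M, hM0, hM⟩ := hy.exists_bound_gradient hφ T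
    refine (LipschitzOnWith.of_dist_le_mul (K := M.toNNReal) fun a ha b hb => ?_).continuousOn
    obtain ⟨s, hs, es⟩ := exists_activeTime_eq φ y (Real.toNNReal_le_iff_le_coe.2 ha.2)
    obtain ⟨t, ht, et⟩ := exists_activeTime_eq φ y (Real.toNNReal_le_iff_le_coe.2 hb.2)
    have := hy.norm_sub_le_activeTime hφ hM ht hs
    rw [hw s, hw t, es, et, Real.coe_toNNReal a ha.1, Real.coe_toNNReal b hb.1] at this
    rwa [dist_eq_norm, Real.dist_eq, Real.coe_toNNReal M hM0]
  hasDeriv t ht := by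
    have := hy.hasDerivWithinAt_reparam hφ hw (τ := t.toNNReal) (t₁ := T)
      ((Real.toNNReal_lt_iff_lt_coe ht.1).2 ht.2)
    rw [Real.coe_toNNReal t ht.1] at this
    exact this.mono (Ici_subset_Ici.2 ht.1)

/-- A solution with finite total active time converges to a critical point. -/
lemma IsSolution.exists_tendsto_of_activeTime_le (hφ : ContDiff ℝ 1 φ)
    (hlb : HasQuadraticLowerBound φ) (hy : IsSolution φ y) {B : ℝ≥0}
    (hB : ∀ t, activeTime φ y t ≤ B) :
    ∃ x, Tendsto y atTop (𝓝 x) ∧ ∇ φ x = 0 := by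
  -- Only values on the range of the active time are used, so the default `0` is harmless.
  obtain ⟨w, hw⟩ : ∃ w : ℝ≥0 → H, ∀ t, y t = w (activeTime φ y t) := by
    classical
    refine ⟨fun τ => if h : ∃ t, activeTime φ y t = τ then y h.choose else 0, fun t => ?_⟩
    have h : ∃ s, activeTime φ y s = activeTime φ y t := ⟨t, rfl⟩
    simp only [dif_pos h]
    exact hy.eq_of_activeTime_eq hφ h.choose_spec.symm
  have m := monotone_activeTime φ y
  have hnorm : ∀ s t, s ≤ t → ‖y t - y s‖ ≤
      ((activeTime φ y t : ℝ) - activeTime φ y s) + (φ (y s) - φ (y t)) := fun s t hst => by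
    have := ((hy.isFlowOn_reparam hφ hw t).mono (activeTime φ y s).2 le_rfl).norm_sub_le hφ
      (NNReal.coe_le_coe.2 (m hst)) one_pos
    simpa [← hw] using this
  obtain ⟨τ, hτ, c, hc⟩ := hlb
  obtain ⟨L, hL⟩ : ∃ L, ∀ t, L ≤ φ (y t) := by
    refine ⟨-c - (φ (y 0) + c + ‖y 0‖ ^ 2 / τ) * Real.exp (2 / τ * B), fun t => ?_⟩
    have h1 := (hy.isFlowOn_reparam hφ hw t).augmentedEnergy_le hφ hτ hc (activeTime φ y t).2
    have h0 : w 0 = y 0 := by rw [hw 0, activeTime_zero]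
    simp only [Real.toNNReal_coe, ← hw, Real.toNNReal_zero, h0, sub_zero] at h1
    have e : ∀ x : H, ‖x‖ ^ 2 / τ = 2 * (1 / (2 * τ) * ‖x‖ ^ 2) := fun x => by field_simp
    have hpos : ∀ x : H, 0 ≤ 1 / (2 * τ) * ‖x‖ ^ 2 := fun x => by positivity
    have h2 : Real.exp (2 / τ * (activeTime φ y t)) ≤ Real.exp (2 / τ * B) :=
      Real.exp_le_exp.2 (mul_le_mul_of_nonneg_left (NNReal.coe_le_coe.2 (hB t)) (by positivity))
    have h3 : 0 ≤ φ (y 0) + c + ‖y 0‖ ^ 2 / τ := by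
      rw [e]; linarith [hc (y 0), hpos (y 0)]
    have h4 := h1.trans (mul_le_mul_of_nonneg_left h2 h3)
    rw [e (y t)] at h4
    linarith [hc (y t), hpos (y t)]
  -- This bounded monotone function dominates the increments of `y` by `hnorm`, so its convergence
  -- makes `y` Cauchy.
  have hmono : Monotone fun t => (activeTime φ y t : ℝ) - φ (y t) := fun s t hst =>
    sub_le_sub (NNReal.coe_le_coe.2 (m hst)) (hy.antitone_energy hφ hst)
  have hbdd : BddAbove (range fun t => (activeTime φ y t : ℝ) - φ (y t)) := by
    refine ⟨B - L, ?_⟩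
    rintro _ ⟨t, rfl⟩
    exact sub_le_sub (NNReal.coe_le_coe.2 (hB t)) (hL t)
  have hcs : CauchySeq y := by
    have h1 := (tendsto_atTop_ciSup hmono hbdd).cauchySeq
    rw [Metric.cauchySeq_iff'] at h1 ⊢
    intro ε hε
    obtain ⟨N, hN⟩ := h1 ε hε
    refine ⟨N, fun n hn => (?_ : _ ≤ _).trans_lt (hN n hn)⟩
    rw [dist_eq_norm, Real.dist_eq]
    exact (hnorm N n hn).trans (by
      refine le_trans (le_of_eq ?_) (le_abs_self _)
      ring)
  obtain ⟨x, hx⟩ := cauchySeq_tendsto_of_complete hcs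
  refine ⟨x, hx, by_contra fun hne => ?_⟩
  -- Near a noncritical limit every late time is active, and `B + 1` further units of time exceed
  -- the bound `B`.
  have hev := (((continuous_gradient hφ).tendsto x).comp hx).eventually_ne hne
  obtain ⟨N, hN⟩ := eventually_atTop.1 hev
  have h1 := coe_activeTime_sub φ y (le_self_add (a := N) (b := B + 1))
  have h2 : activeSet φ y ∩ Ioc (N : ℝ) (N + (B + 1) : ℝ≥0) = Ioc (N : ℝ) (N + (B + 1) : ℝ≥0) :=
    inter_eq_right.2 fun s hs => hN _ (NNReal.le_toNNReal_of_coe_le hs.1.le)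
  rw [h2, Real.volume_real_Ioc] at h1
  have h3 := NNReal.coe_le_coe.2 (hB (N + (B + 1)))
  have h4 := (activeTime φ y N).2
  push_cast at h1
  have h5 := le_max_left ((N : ℝ) + (B + 1) - N) 0
  rw [← h1] at h5
  have h6 : (0 : ℝ) ≤ activeTime φ y N := NNReal.coe_nonneg _
  linarith

/-- Every solution is a slowed-down version of a solution running at active time. -/
theorem IsSolution.exists_reduction (hφ : ContDiff ℝ 1 φ) (hlb : HasQuadraticLowerBound φ)
    (hy : IsSolution φ y) :
    ∃ w, IsSolution φ w ∧ (∀ t, y t = w (activeTime φ y t)) ∧ range w ⊆ closure (range y) ∧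
      ∀ τ, τ ∉ range (activeTime φ y) → ∀ σ, τ ≤ σ → w σ = w τ := by
  classical
  have m := monotone_activeTime φ y
  -- The limit of `y` when the total active time is finite, an irrelevant `0` otherwise.
  obtain ⟨x, hx⟩ : ∃ x, (∃ B, ∀ t, activeTime φ y t ≤ B) → Tendsto y atTop (𝓝 x) ∧ ∇ φ x = 0 := by
    by_cases h : ∃ B, ∀ t, activeTime φ y t ≤ B
    · obtain ⟨B, hB⟩ := h
      obtain ⟨x, hx⟩ := hy.exists_tendsto_of_activeTime_le hφ hlb hB
      exact ⟨x, fun _ => hx⟩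
    · exact ⟨0, fun h' => absurd h' h⟩
  let w : ℝ≥0 → H := fun τ => if h : ∃ t, activeTime φ y t = τ then y h.choose else x
  have hw : ∀ t, y t = w (activeTime φ y t) := fun t => by
    have h : ∃ s, activeTime φ y s = activeTime φ y t := ⟨t, rfl⟩
    simp only [w, dif_pos h]
    exact hy.eq_of_activeTime_eq hφ h.choose_spec.symm
  have hwx : ∀ τ, (∀ t, activeTime φ y t ≤ τ) → w τ = x := fun τ hτ => by
    by_cases h : ∃ t, activeTime φ y t = τ
    · obtain ⟨t, rfl⟩ := h
      rw [← hw]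
      refine tendsto_nhds_unique (tendsto_const_nhds.congr' ?_) (hx ⟨_, hτ⟩).1
      filter_upwards [eventually_ge_atTop t] with s hs
      exact hy.eq_of_activeTime_eq hφ (le_antisymm (m hs) (hτ s))
    · simp only [w, dif_neg h]
  have hbd : ∀ τ, τ ∉ range (activeTime φ y) → ∀ t, activeTime φ y t ≤ τ := fun τ hτ t => by
    by_contra! hlt
    obtain ⟨s, -, e⟩ := exists_activeTime_eq φ y hlt.le
    exact hτ ⟨s, e⟩
  refine ⟨w, fun τ => ?_, hw, ?_, fun τ hτ σ hσ => ?_⟩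
  · by_cases hA : ∃ t₁, τ < activeTime φ y t₁
    · obtain ⟨t₁, h₁⟩ := hA
      exact hy.hasDerivWithinAt_reparam hφ hw h₁
    push Not at hA
    obtain ⟨hlim, hx0⟩ := hx ⟨τ, hA⟩
    have hafter : ∀ σ, τ ≤ σ → w σ = x := fun σ hσ => hwx σ fun t => (hA t).trans hσ
    refine hasDerivWithinAt_toNNReal_of_forall fun ε hε => ?_
    -- Here `τ` is at or beyond the total active time, so `w` rests at `x` from `τ` on. If `τ` is
    -- attained, `y` supplies the left difference quotient; if not, that quotient is bounded by
    -- letting `s → ∞` in the increments of `y`, where the gradient is already smaller than `ε`.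
    by_cases hatt : ∃ t₀, activeTime φ y t₀ = τ
    · obtain ⟨t₀, rfl⟩ := hatt
      obtain ⟨δ, hδ, hδ'⟩ := hy.reparam_estimate hφ hw le_rfl hε
      refine ⟨δ, hδ, fun σ hσ => ?_⟩
      rcases le_total σ (activeTime φ y t₀) with h | h
      · exact hδ' σ h hσ
      · rw [hafter σ h, hafter _ le_rfl, hx0]
        simpa using mul_nonneg hε.le (abs_nonneg _)
    · have hlt : ∀ t, activeTime φ y t < τ := fun t =>
        lt_of_le_of_ne (hA t) fun e => hatt ⟨t, e⟩
      have hev : ∀ᶠ t in atTop, ‖∇ φ (y t)‖ < ε := by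
        have := (((continuous_gradient hφ).tendsto x).comp hlim).norm
        rw [hx0, norm_zero] at this
        exact this.eventually_lt_const hε
      obtain ⟨N, hN⟩ := eventually_atTop.1 hev
      refine ⟨τ - activeTime φ y N, sub_pos.2 (NNReal.coe_lt_coe.2 (hlt N)), fun σ hσ => ?_⟩
      rw [hafter τ le_rfl, hx0, smul_zero, add_zero]
      by_cases hσA : ∃ t, σ < activeTime φ y t
      · obtain ⟨t₁, ht₁⟩ := hσA
        obtain ⟨t, -, rfl⟩ := exists_activeTime_eq φ y ht₁.le
        have hle := NNReal.coe_le_coe.2 (hA t)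
        rw [abs_sub_comm, abs_of_nonneg (sub_nonneg.2 hle)] at hσ ⊢
        have hNt : N ≤ t := by
          by_contra! hlt'
          have := NNReal.coe_le_coe.2 (m hlt'.le)
          linarith
        rw [← hw, norm_sub_rev]
        refine le_of_tendsto (hlim.sub_const (y t)).norm ?_
        filter_upwards [eventually_ge_atTop t] with s hs
        have h1 := hy.norm_sub_add_activeTime_smul_le hφ hs (g := 0) (ε := ε)
          (fun r hr _ => by simpa using (hN r (hNt.trans hr)).le)
        rw [smul_zero, add_zero] at h1
        refine h1.trans (mul_le_mul_of_nonneg_left ?_ hε.le)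
        exact sub_le_sub_right (NNReal.coe_le_coe.2 (hA s)) _
      · push Not at hσA
        rw [hwx σ hσA, sub_self, norm_zero]
        positivity
  · rintro _ ⟨τ, rfl⟩
    by_cases h : ∃ t, activeTime φ y t = τ
    · obtain ⟨t, rfl⟩ := h
      rw [← hw]
      exact subset_closure ⟨t, rfl⟩
    · rw [hwx τ (hbd τ h)]
      exact mem_closure_of_tendsto (hx ⟨τ, hbd τ h⟩).1 (Eventually.of_forall fun t => ⟨t, rfl⟩)
  · rw [hwx τ (hbd τ hτ), hwx σ fun t => (hbd τ hτ t).trans hσ]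

end Reduction

/-! ### Active time depends only on the trace. -/

section Comparison

variable {φ : H → ℝ} {u v w y : ℝ≥0 → H}

lemma IsSolution.injOn_energy (hφ : ContDiff ℝ 1 φ) (hu : IsSolution φ u) :
    InjOn (fun r : ℝ => φ (u r.toNNReal)) (activeSet φ u ∩ Ici 0) := by
  intro r hr s hs h
  wlog hlt : r < s generalizing r s
  · rcases eq_or_lt_of_le (not_lt.1 hlt) with h' | h'
    · exact h'.symm
    · exact (this hs hr h.symm h').symm
  exact absurd (hu.gradient_eq_zero hφ ((Real.toNNReal_lt_toNNReal_iff_of_nonneg hr.2).2 hlt)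
    (hu.eq_of_energy_eq hφ h)) hr.1

lemma IsSolution.hasDerivWithinAt_energy (hφ : ContDiff ℝ 1 φ) (hu : IsSolution φ u) {r : ℝ}
    (hr : 0 ≤ r) : HasDerivWithinAt (fun s : ℝ => φ (u s.toNNReal))
      (-‖∇ φ (u r.toNNReal)‖ ^ 2) (Ici 0) r := by
  have := hu r.toNNReal
  rw [Real.coe_toNNReal r hr] at this
  exact GradientFlow.hasDerivWithinAt_energy hφ this

/-- The active time only depends on the trace of the solution: it is the integral of
`1 / ‖∇φ‖ ^ 2` with respect to the energy. -/
lemma IsSolution.activeTime_le_of_image_subset (hφ : ContDiff ℝ 1 φ) (hu : IsSolution φ u)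
    (hv : IsSolution φ v) {s t : ℝ≥0} (h : u '' Iic s ⊆ v '' Iic t) :
    activeTime φ u s ≤ activeTime φ v t := by
  rw [← ENNReal.coe_le_coe, coe_activeTime, coe_activeTime]
  set A := activeSet φ u ∩ Icc 0 (s : ℝ)
  set B := activeSet φ v ∩ Icc 0 (t : ℝ)
  set e : ℝ → ℝ := fun r => φ (v r.toNNReal) with he
  have hA : MeasurableSet A := (isOpen_activeSet hφ hu).measurableSet.inter measurableSet_Icc
  have hB : MeasurableSet B := (isOpen_activeSet hφ hv).measurableSet.inter measurableSet_Icc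
  -- `1 / ‖∇φ‖²` as a function of the energy; the chosen preimage does not matter, since energy
  -- determines the point along `v`.
  set G : ℝ → ℝ≥0∞ := fun r =>
    ENNReal.ofReal (1 / ‖∇ φ (v (Function.invFunOn e B r).toNNReal)‖ ^ 2) with hG
  have hGv : ∀ r ∈ B, ∀ x, φ x = φ (v r.toNNReal) → x ∈ range v →
      G (φ x) = ENNReal.ofReal (1 / ‖∇ φ x‖ ^ 2) := by
    rintro r hr _ hx ⟨q, rfl⟩
    have h1 : ∃ a ∈ B, e a = φ (v q) := ⟨r, hr, hx.symm⟩
    have h2 : v (Function.invFunOn e B (φ (v q))).toNNReal = v q :=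
      hv.eq_of_energy_eq hφ (Function.invFunOn_eq h1)
    simp only [hG, h2]
  have hAB : ∀ r ∈ A, ∃ q ∈ B, v q.toNNReal = u r.toNNReal := by
    rintro r ⟨hr, hr0, hrs⟩
    obtain ⟨q, hq, hqe⟩ := h ⟨r.toNNReal, Real.toNNReal_le_iff_le_coe.2 hrs, rfl⟩
    refine ⟨q, ⟨?_, q.2, hq⟩, by simpa using hqe⟩
    simp only [activeSet, mem_ofPred_eq, Real.toNNReal_coe, hqe]
    exact hr
  have hone : ∀ x : H, ∇ φ x ≠ 0 →
      ENNReal.ofReal |-‖∇ φ x‖ ^ 2| * ENNReal.ofReal (1 / ‖∇ φ x‖ ^ 2) = 1 := fun x hx => by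
    have := norm_pos_iff.2 hx
    rw [← ENNReal.ofReal_mul (abs_nonneg _), abs_neg, abs_of_nonneg (by positivity),
      mul_one_div_cancel (by positivity), ENNReal.ofReal_one]
  have change : ∀ {x : ℝ≥0 → H} {T : ℝ}, IsSolution φ x →
      MeasurableSet (activeSet φ x ∩ Icc 0 T) →
      (∀ r ∈ activeSet φ x ∩ Icc 0 T,
        G (φ (x r.toNNReal)) = ENNReal.ofReal (1 / ‖∇ φ (x r.toNNReal)‖ ^ 2)) →
      volume (activeSet φ x ∩ Icc 0 T) =
        ∫⁻ a in (fun r : ℝ => φ (x r.toNNReal)) '' (activeSet φ x ∩ Icc 0 T), G a := by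
    intro x T hx hm hGx
    rw [lintegral_image_eq_lintegral_abs_deriv_mul hm
      (fun r hr => (hx.hasDerivWithinAt_energy hφ hr.2.1).mono fun a ha => ha.2.1)
      ((hx.injOn_energy hφ).mono (inter_subset_inter_right _ Icc_subset_Ici_self)), ← setLIntegral_one]
    exact setLIntegral_congr_fun hm fun r hr => by
      simp only [hGx r hr]
      exact (hone (x r.toNNReal) hr.1).symm
  have hGu : ∀ r ∈ A, G (φ (u r.toNNReal)) = ENNReal.ofReal (1 / ‖∇ φ (u r.toNNReal)‖ ^ 2) := by
    intro r hr
    obtain ⟨q, hq, hqe⟩ := hAB r hr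
    exact hGv q hq (u r.toNNReal) (by rw [hqe]) ⟨_, hqe⟩
  rw [change hu hA hGu,
    change hv hB fun r hr => hGv r hr (v r.toNNReal) rfl ⟨_, rfl⟩]
  refine lintegral_mono_set ?_
  rintro _ ⟨r, hr, rfl⟩
  obtain ⟨q, hq, hqe⟩ := hAB r hr
  exact ⟨q, hq, by simp only [hqe]⟩

/-- Two solutions which reach the same point along the same trace do so in the same active time. -/
lemma IsSolution.activeTime_eq_of_eq (hφ : ContDiff ℝ 1 φ) (hu : IsSolution φ u)
    (hv : IsSolution φ v) (h0 : v 0 = u 0) {s t : ℝ≥0} (hst : u s = v t)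
    (h : v '' Iic t ⊆ range u) : activeTime φ u s = activeTime φ v t := by
  refine le_antisymm (hu.activeTime_le_of_image_subset hφ hv ?_)
    (hv.activeTime_le_of_image_subset hφ hu ?_)
  -- `v` takes the energy of `u r` at some time before `t`, at a point which lies on the trace of
  -- `u`, where energy determines the point.
  · rintro _ ⟨r, hr, rfl⟩
    obtain ⟨q, hq, hqe⟩ := intermediate_value_Icc' (zero_le (a := t))
      (hv.continuous_energy hφ).continuousOn (show φ (u r) ∈ Icc (φ (v t)) (φ (v 0)) from
        ⟨hst ▸ hu.antitone_energy hφ hr, h0 ▸ hu.antitone_energy hφ zero_le⟩)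
    refine ⟨q, hq.2, ?_⟩
    obtain ⟨p, hp⟩ := h ⟨q, hq.2, rfl⟩
    simp only [← hp] at hqe ⊢
    exact hu.eq_of_energy_eq hφ hqe
  · rintro _ ⟨r, hr, rfl⟩
    obtain ⟨p, hp⟩ := h ⟨r, hr, rfl⟩
    rcases le_total p s with hps | hps
    · exact ⟨p, hps, hp⟩
    · refine ⟨s, self_mem_Iic, ?_⟩
      rw [← hp]
      refine (hu.eq_of_energy_le hφ hps ?_).symm
      rw [hst, hp]
      exact hv.antitone_energy hφ hr

lemma energy_le_of_mem_closure {E : Type*} [TopologicalSpace E] {φ : E → ℝ} (hφ : Continuous φ) {c : ℝ} {S : Set E} (h : ∀ x ∈ S, c ≤ φ x)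
    {x : E} (hx : x ∈ closure S) : c ≤ φ x :=
  closure_minimal (show S ⊆ φ ⁻¹' Ici c from h) (isClosed_Ici.preimage hφ) hx

lemma energy_ge_of_mem_closure {E : Type*} [TopologicalSpace E] {φ : E → ℝ} (hφ : Continuous φ) {c : ℝ} {S : Set E} (h : ∀ x ∈ S, φ x ≤ c)
    {x : E} (hx : x ∈ closure S) : φ x ≤ c :=
  closure_minimal (show S ⊆ φ ⁻¹' Iic c from h) (isClosed_Iic.preimage hφ) hx

end Comparison

/-! ### The stopping time. -/

section Tstar

variable {E : Type*} {u : ℝ≥0 → E} {t : ℝ≥0}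

lemma Tstar_le (h : ∀ s, t ≤ s → u s = u t) : Tstar u ≤ t := sInf_le ⟨t, h, rfl⟩

/-- By continuity the infimum is attained: `u r = u s` for `r` slightly above `t`, then `r`
decreases to `t`. -/
lemma eq_of_Tstar_le [TopologicalSpace E] [T2Space E] (hu : Continuous u) (h : Tstar u ≤ t)
    {s : ℝ≥0} (hs : t ≤ s) : u s = u t := by
  rcases hs.eq_or_lt with rfl | hs
  · rfl
  refine tendsto_nhds_unique (tendsto_const_nhds.congr' ?_)
    ((hu.tendsto t).mono_left (nhdsWithin_le_nhds (s := Ioi t)))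
  filter_upwards [Ioo_mem_nhdsGT hs] with r hr
  obtain ⟨_, ⟨q, hq, rfl⟩, hqr⟩ := sInf_lt_iff.1 (h.trans_lt (ENNReal.coe_lt_coe.2 hr.1))
  have hqr' : q < r := ENNReal.coe_lt_coe.1 hqr
  rw [hq s (hqr'.trans hr.2).le, hq r hqr'.le]

lemma lt_Tstar_iff [TopologicalSpace E] [T2Space E] (hu : Continuous u) :
    (t : ℝ≥0∞) < Tstar u ↔ ∃ s, t < s ∧ u s ≠ u t := by
  refine ⟨fun h => ?_, fun ⟨s, hs, hne⟩ => lt_of_not_ge fun hle => hne (eq_of_Tstar_le hu hle hs.le)⟩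
  by_contra! hc
  refine absurd h (not_lt.2 (Tstar_le fun s hs => ?_))
  rcases hs.eq_or_lt with rfl | hs
  · rfl
  · exact hc s hs

end Tstar

section Succ

variable {E : Type*} [NormedAddCommGroup E] {u v : ℝ≥0 → E}

lemma Succ.exists_le (h : Succ u v) : range v ⊆ closure (range u) ∧ u 0 = v 0 ∧
    ∃ z : ℝ≥0 → ℝ≥0, (∀ t, z t ≤ t) ∧ ∀ t, u t = v (z t) := by
  obtain ⟨hr, z, h0, -, hl, hz⟩ := h
  refine ⟨hr, by rw [hz, h0], z, fun t => ?_, hz⟩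
  have := hl.dist_le_mul t 0
  rw [h0, NNReal.dist_eq, NNReal.dist_eq] at this
  simpa using this

lemma Succ.range_subset (h : Succ u v) : range u ⊆ range v := by
  obtain ⟨-, z, -, -, -, hz⟩ := h
  rintro _ ⟨t, rfl⟩
  exact ⟨z t, (hz t).symm⟩

end Succ

/-! ### Regular solutions and minimality. -/

section Regular

variable {φ : H → ℝ} {u v w y : ℝ≥0 → H}

/-- Solutions which spend almost no time at critical points before they stop. -/
def IsRegular (φ : H → ℝ) (u : ℝ≥0 → H) : Prop :=
  ∀ t : ℝ≥0, (t : ℝ≥0∞) < Tstar u → activeTime φ u t = t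

lemma IsRegular.min_Tstar_le (h : IsRegular φ u) (t : ℝ≥0) :
    min (t : ℝ≥0∞) (Tstar u) ≤ activeTime φ u t := by
  refine le_of_forall_lt_imp_le_of_dense fun c hc => ?_
  lift c to ℝ≥0 using (hc.trans_le (min_le_left _ _)).ne_top with r
  rw [← h r (hc.trans_le (min_le_right _ _)), ENNReal.coe_le_coe]
  exact monotone_activeTime φ u (ENNReal.coe_lt_coe.1 (hc.trans_le (min_le_left _ _))).le

lemma isRegular_iff_min_Tstar_le :
    IsRegular φ u ↔ ∀ t : ℝ≥0, min (t : ℝ≥0∞) (Tstar u) ≤ activeTime φ u t := by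
  refine ⟨fun h => h.min_Tstar_le, fun h t ht => le_antisymm (activeTime_le φ u t) ?_⟩
  have := h t
  rwa [min_eq_left ht.le, ENNReal.coe_le_coe] at this

lemma isRegular_iff_volume_eq_zero (hφ : ContDiff ℝ 1 φ) (hu : IsSolution φ u) :
    IsRegular φ u ↔ (volume : Measure ℝ) ((fun t : ℝ≥0 => (t : ℝ)) ''
      {t : ℝ≥0 | (t : ℝ≥0∞) < Tstar u ∧ ∇ φ (u t) = 0}) = 0 := by
  have hm := (isOpen_activeSet hφ hu).measurableSet
  have hsplit : ∀ t : ℝ≥0, (activeTime φ u t : ℝ≥0∞) +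
      volume (Icc 0 (t : ℝ) \ activeSet φ u) = t := fun t => by
    rw [coe_activeTime, inter_comm, measure_inter_add_sdiff _ hm]
    simp [Real.volume_Icc]
  have hiff : ∀ t : ℝ≥0, activeTime φ u t = t ↔ volume (Icc 0 (t : ℝ) \ activeSet φ u) = 0 :=
    fun t => by
      constructor
      · intro h
        have := hsplit t
        rw [h] at this
        exact (ENNReal.add_right_inj ENNReal.coe_ne_top).1 (this.trans (add_zero _).symm)
      · intro h
        have := hsplit t
        rwa [h, add_zero, ENNReal.coe_inj] at this
  constructor
  · intro h
    -- Rational truncation times make the union countable; `Tstar u` itself may be infinite.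
    refine measure_mono_null (t := ⋃ q : ℚ, ⋃ _ : ((Real.toNNReal q : ℝ≥0) : ℝ≥0∞) < Tstar u,
      Icc 0 ((Real.toNNReal q : ℝ≥0) : ℝ) \ activeSet φ u) ?_ ?_
    · rintro _ ⟨t, ⟨ht, hgrad⟩, rfl⟩
      obtain ⟨q, -, hq1, hq2⟩ := ENNReal.lt_iff_exists_rat_btwn.1 ht
      simp only [mem_iUnion]
      refine ⟨q, hq2, ⟨t.2, NNReal.coe_le_coe.2 (ENNReal.coe_lt_coe.1 hq1).le⟩, ?_⟩
      simpa [activeSet] using hgrad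
    · exact measure_iUnion_null fun q => measure_iUnion_null fun hq => (hiff _).1 (h _ hq)
  · intro h t ht
    refine (hiff t).2 (measure_mono_null ?_ h)
    rintro r ⟨⟨hr0, hrt⟩, hr⟩
    refine ⟨r.toNNReal, ⟨?_, by simpa [activeSet] using hr⟩, Real.coe_toNNReal r hr0⟩
    exact (ENNReal.coe_le_coe.2 (Real.toNNReal_le_iff_le_coe.2 hrt)).trans_lt ht

/-- `w` runs through `y` at active time. -/
structure IsReduction (φ : H → ℝ) (y w : ℝ≥0 → H) : Prop where
  isSolution : IsSolution φ w
  eq_comp : ∀ t, y t = w (activeTime φ y t)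
  range_subset : range w ⊆ closure (range y)
  eq_of_notMem : ∀ τ, τ ∉ range (activeTime φ y) → ∀ σ, τ ≤ σ → w σ = w τ

namespace IsReduction

lemma zero_eq (h : IsReduction φ y w) : w 0 = y 0 := by rw [h.eq_comp, activeTime_zero]

lemma subset_range (h : IsReduction φ y w) : range y ⊆ range w := by
  rintro _ ⟨t, rfl⟩
  exact ⟨_, (h.eq_comp t).symm⟩

lemma succ (h : IsReduction φ y w) : Succ y w :=
  ⟨h.range_subset, activeTime φ y, activeTime_zero φ y, monotone_activeTime φ y,
    lipschitzWith_activeTime φ y, h.eq_comp⟩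

/-- At `τ = activeTime φ y t` the points `w τ` and `y t` agree, so the trace forces equal active
times. A `τ` that is not attained lies past the stopping time. -/
lemma isRegular (hφ : ContDiff ℝ 1 φ) (hy : IsSolution φ y) (h : IsReduction φ y w) :
    IsRegular φ w := by
  intro τ hτ
  obtain ⟨t, rfl⟩ : τ ∈ range (activeTime φ y) := by
    by_contra hc
    exact absurd hτ (not_lt.2 (Tstar_le (h.eq_of_notMem τ hc)))
  exact h.isSolution.activeTime_eq_of_eq hφ hy h.zero_eq.symm (h.eq_comp t).symm
    ((image_subset_range _ _).trans h.subset_range)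

end IsReduction

lemma IsSolution.exists_isReduction (hφ : ContDiff ℝ 1 φ) (hlb : HasQuadraticLowerBound φ)
    (hy : IsSolution φ y) : ∃ w, IsReduction φ y w := by
  obtain ⟨w, h1, h2, h3, h4⟩ := hy.exists_reduction hφ hlb
  exact ⟨w, h1, h2, h3, h4⟩

/-- Before `u` stops, `t` is the active time of `v` at `z t`, hence at most `z t ≤ t`. Afterwards
`v` has no energy left to lose, because its range lies in the closure of that of `u`. -/
lemma IsRegular.eq_of_succ (hφ : ContDiff ℝ 1 φ) (hreg : IsRegular φ u) (hu : IsSolution φ u)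
    (hv : IsSolution φ v) (h : Succ u v) : u = v := by
  obtain ⟨hcl, h0, z, hz, hzu⟩ := h.exists_le
  funext t
  rcases lt_or_ge (t : ℝ≥0∞) (Tstar u) with ht | ht
  · have h1 := hv.activeTime_eq_of_eq hφ hu h0 (hzu t).symm
      ((image_subset_range _ _).trans h.range_subset)
    rw [hreg t ht] at h1
    have h2 : z t = t := le_antisymm (hz t) (h1.symm.le.trans (activeTime_le φ v (z t)))
    rw [hzu t, h2]
  · rw [hzu t]
    refine (hv.eq_of_energy_le hφ (hz t) ?_).symm
    rw [← hzu t]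
    refine energy_le_of_mem_closure hφ.continuous ?_ (hcl ⟨t, rfl⟩)
    rintro _ ⟨s, rfl⟩
    rcases le_total s t with hst | hst
    · exact hu.antitone_energy hφ hst
    · rw [eq_of_Tstar_le hu.continuous ht hst]

theorem isMinimal_iff_isRegular (hφ : ContDiff ℝ 1 φ) (hlb : HasQuadraticLowerBound φ)
    (hu : IsSolution φ u) : IsMinimal φ u ↔ IsRegular φ u := by
  refine ⟨fun h => ?_, fun h => ⟨hu, fun v hv => h.eq_of_succ hφ hu hv⟩⟩
  obtain ⟨w, hw⟩ := hu.exists_isReduction hφ hlb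
  have := h.2 w hw.isSolution hw.succ
  rw [this]
  exact hw.isRegular hφ hu

lemma IsMinimal.isRegular (hφ : ContDiff ℝ 1 φ) (hlb : HasQuadraticLowerBound φ)
    (hu : IsMinimal φ u) : IsRegular φ u := (isMinimal_iff_isRegular hφ hlb hu.1).1 hu

lemma IsReduction.isMinimal (hφ : ContDiff ℝ 1 φ) (hlb : HasQuadraticLowerBound φ)
    (hy : IsSolution φ y) (h : IsReduction φ y w) : IsMinimal φ w :=
  (isMinimal_iff_isRegular hφ hlb h.isSolution).2 (h.isRegular hφ hy)

end Regular

section Order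

variable {E : Type*} [NormedAddCommGroup E] {u v w : ℝ≥0 → E}

lemma Succ.refl (u : ℝ≥0 → E) : Succ u u :=
  ⟨subset_closure, id, rfl, monotone_id, LipschitzWith.id, fun _ => rfl⟩

lemma Succ.trans (huv : Succ u v) (hvw : Succ v w) : Succ u w := by
  obtain ⟨hr, z, h0, hm, hl, hz⟩ := huv
  obtain ⟨hr', z', h0', hm', hl', hz'⟩ := hvw
  refine ⟨hr'.trans (closure_minimal hr isClosed_closure), z' ∘ z, by simp [h0, h0'], hm'.comp hm,
    by simpa using hl'.comp hl, fun t => by rw [hz, hz']; rfl⟩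

end Order

/-! ### Order structure and variational characterizations. -/

section MinimalSolutions

variable {φ : H → ℝ} {u v w y : ℝ≥0 → H}

/-- Each curve is delayed with respect to the other, so `v` loses no energy between `z t` and `t`.
-/
lemma Succ.antisymm (hφ : ContDiff ℝ 1 φ) (hu : IsSolution φ u) (hv : IsSolution φ v)
    (huv : Succ u v) (hvu : Succ v u) : u = v := by
  obtain ⟨-, -, z, hz, e⟩ := huv.exists_le
  obtain ⟨-, -, z', hz', e'⟩ := hvu.exists_le
  funext t
  rw [e t]
  refine (hv.eq_of_energy_le hφ (hz t) ?_).symm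
  rw [← e t, e' t]
  exact hu.antitone_energy hφ (hz' t)

/-- The tail after `t` has energy at most `φ (y t)` and cannot accumulate at `x`; the initial piece
is compact. -/
lemma IsSolution.mem_range_of_energy_lt (hφ : ContDiff ℝ 1 φ) (hy : IsSolution φ y) {x : H}
    (hx : x ∈ closure (range y)) {t : ℝ≥0} (ht : φ (y t) < φ x) : x ∈ range y := by
  have h1 : range y = y '' Iic t ∪ y '' Ici t := by
    rw [← image_union, Iic_union_Ici, image_univ]
  have h2 : IsCompact (y '' Iic t) := by
    rw [← Icc_bot]
    exact isCompact_Icc.image hy.continuous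
  rw [h1, closure_union, h2.isClosed.closure_eq] at hx
  rcases hx with hx | hx
  · exact image_subset_range _ _ hx
  · refine absurd ht (not_lt.2 (energy_ge_of_mem_closure hφ.continuous ?_ hx))
    rintro _ ⟨s, hs, rfl⟩
    exact hy.antitone_energy hφ hs

lemma IsSolution.activeTime_eq (hφ : ContDiff ℝ 1 φ) (hu : IsSolution φ u) {s t : ℝ≥0}
    (h : u s = u t) : activeTime φ u s = activeTime φ u t :=
  hu.activeTime_eq_of_eq hφ hu rfl h (image_subset_range _ _)

/-- The reduction of `y` lies below every solution with the same trace up to the closure. -/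
lemma IsReduction.succ_of_range_subset (hφ : ContDiff ℝ 1 φ) (hy : IsSolution φ y)
    (h : IsReduction φ y w) (hv : IsSolution φ v) (hyv : range y ⊆ range v)
    (hvy : range v ⊆ closure (range y)) : Succ v w := by
  have h0 : y 0 = v 0 := by
    obtain ⟨s, hs⟩ := hyv ⟨0, rfl⟩
    rw [← hs]
    refine hv.eq_of_energy_le hφ zero_le ?_
    rw [hs]
    refine energy_ge_of_mem_closure hφ.continuous ?_ (hvy ⟨0, rfl⟩)
    rintro _ ⟨t, rfl⟩
    exact hy.antitone_energy hφ zero_le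
  have hclosed : IsClosed {t | v t = w (activeTime φ v t)} :=
    isClosed_eq hv.continuous (h.isSolution.continuous.comp (continuous_activeTime φ v))
  have hmem : ∀ t, v t ∈ range y → v t = w (activeTime φ v t) := by
    rintro t ⟨s, hs⟩
    rw [hv.activeTime_eq_of_eq hφ hy h0 hs.symm ((image_subset_range _ _).trans hyv), ← h.eq_comp,
      hs]
  refine ⟨h.range_subset.trans (closure_mono hyv), activeTime φ v, activeTime_zero φ v,
    monotone_activeTime φ v, lipschitzWith_activeTime φ v, fun t => ?_⟩
  by_cases ht : v t ∈ range y
  · exact hmem t ht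
  -- A point of the closure outside `range y` has energy no larger than any on `range y`. So once
  -- `v` has left the trace of `y` for good it is constant, and the identity extends from `sSup S`.
  set S := {r | r ≤ t ∧ v r ∈ range y}
  have hS : S.Nonempty := ⟨0, zero_le, 0, h0⟩
  have hSb : BddAbove S := ⟨t, fun r hr => hr.1⟩
  have ht₀ : v (sSup S) = w (activeTime φ v (sSup S)) :=
    closure_minimal (fun r hr => hmem r hr.2) hclosed (csSup_mem_closure hS hSb)
  have hle : sSup S ≤ t := csSup_le hS fun r hr => hr.1
  rcases hle.eq_or_lt with he | hlt
  · rwa [he] at ht₀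
  have hafter : ∀ r ∈ Ioc (sSup S) t, v r = v t := by
    intro r hr
    have hr' : v r ∉ range y := fun hc => absurd (le_csSup hSb ⟨hr.2, hc⟩) (not_le.2 hr.1)
    refine (hv.eq_of_energy_le hφ hr.2 ?_).symm
    refine energy_le_of_mem_closure hφ.continuous ?_ (hvy ⟨t, rfl⟩)
    rintro _ ⟨s, rfl⟩
    by_contra! hc
    exact hr' (hy.mem_range_of_energy_lt hφ (hvy ⟨r, rfl⟩) hc)
  have heq : v (sSup S) = v t := by
    refine closure_minimal hafter (isClosed_eq hv.continuous continuous_const) ?_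
    rw [closure_Ioc hlt.ne]
    exact left_mem_Icc.2 hle
  rw [← heq, ht₀, hv.activeTime_eq hφ heq]

theorem existsUnique_minimal_of_range (hφ : ContDiff ℝ 1 φ) (hlb : HasQuadraticLowerBound φ)
    (hy : IsSolution φ y) :
    ∃ u, (IsMinimal φ u ∧ range y ⊆ range u ∧ range u ⊆ closure (range y)) ∧
      (∀ u', IsMinimal φ u' → range y ⊆ range u' → range u' ⊆ closure (range y) → u' = u) ∧
      ∀ v, IsSolution φ v → range y ⊆ range v → range v ⊆ closure (range y) → Succ v u := by
  obtain ⟨w, hw⟩ := hy.exists_isReduction hφ hlb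
  exact ⟨w, ⟨hw.isMinimal hφ hlb hy, hw.subset_range, hw.range_subset⟩,
    fun u' hu' h1 h2 => hu'.2 w hw.isSolution (hw.succ_of_range_subset hφ hy hu'.1 h1 h2),
    fun v hv h1 h2 => hw.succ_of_range_subset hφ hy hv h1 h2⟩

theorem existsUnique_minimal_succ (hφ : ContDiff ℝ 1 φ) (hlb : HasQuadraticLowerBound φ)
    (hv : IsSolution φ v) : ∃! u, IsMinimal φ u ∧ Succ v u := by
  obtain ⟨w, hw⟩ := hv.exists_isReduction hφ hlb
  exact ⟨w, ⟨hw.isMinimal hφ hlb hv, hw.succ⟩, fun u hu =>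
    hu.1.2 w hw.isSolution (hw.succ_of_range_subset hφ hv hu.1.1 hu.2.range_subset hu.2.1)⟩

lemma IsTruncatedSolution.exists_isSolution (hv : IsTruncatedSolution φ v) (t : ℝ≥0) :
    ∃ w, IsSolution φ w ∧ ∃ t' ≤ t, w t' = v t ∧ ∀ r ≤ t', w r = v r := by
  rcases hv with hv | ⟨w, hw, T, hT⟩
  · exact ⟨v, hv, t, le_rfl, rfl, fun _ _ => rfl⟩
  · refine ⟨w, hw, min t T, min_le_left _ _, (hT t).symm, fun r hr => ?_⟩
    rw [hT, min_eq_left (hr.trans (min_le_right _ _))]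

/-- A regular solution reaches each point of its trace before any other truncated solution which
stays in the closure of that trace. -/
lemma IsRegular.min_Tstar_le_of_eq (hφ : ContDiff ℝ 1 φ) (hu : IsSolution φ u)
    (hreg : IsRegular φ u) (hv : IsTruncatedSolution φ v) (h0 : v 0 = u 0)
    (hvu : range v ⊆ closure (range u)) {t₀ t₁ : ℝ≥0} (h : u t₀ = v t₁) :
    min (t₀ : ℝ≥0∞) (Tstar u) ≤ t₁ := by
  obtain ⟨w, hw, t', ht', hwt, hwv⟩ := hv.exists_isSolution t₁
  have hsub : w '' Iic t' ⊆ range u := by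
    rintro _ ⟨r, hr, rfl⟩
    rcases (hw.antitone_energy hφ hr).eq_or_lt with he | hlt
    · exact ⟨t₀, by rw [h, ← hwt]; exact hw.eq_of_energy_eq hφ he⟩
    · refine hu.mem_range_of_energy_lt hφ (hvu ⟨r, (hwv r hr).symm⟩) (t := t₀) ?_
      rwa [h, ← hwt]
  refine (hreg.min_Tstar_le t₀).trans (ENNReal.coe_le_coe.2 ?_)
  rw [hu.activeTime_eq_of_eq hφ hw ((hwv 0 zero_le).trans h0) (h.trans hwt.symm) hsub]
  exact (activeTime_le φ w t').trans ht'

theorem isMinimal_iff_min_Tstar_le (hφ : ContDiff ℝ 1 φ) (hlb : HasQuadraticLowerBound φ)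
    (hu : IsSolution φ u) : IsMinimal φ u ↔
      ∀ v, IsTruncatedSolution φ v → v 0 = u 0 → range v ⊆ closure (range u) →
        ∀ t₀ t₁ : ℝ≥0, u t₀ = v t₁ → min (t₀ : ℝ≥0∞) (Tstar u) ≤ t₁ := by
  rw [isMinimal_iff_isRegular hφ hlb hu]
  refine ⟨fun hreg v hv h0 hvu t₀ t₁ h => hreg.min_Tstar_le_of_eq hφ hu hv h0 hvu h, fun h => ?_⟩
  obtain ⟨w, hw⟩ := hu.exists_isReduction hφ hlb
  exact isRegular_iff_min_Tstar_le.2 fun t =>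
    h w (Or.inl hw.isSolution) hw.zero_eq hw.range_subset t _ (hw.eq_comp t)

/-- If `v` were strictly lower at `t`, it would already have passed an intermediate energy on the
trace of `u`, at a point which `u` reaches only after `t`. This contradicts
`IsRegular.min_Tstar_le_of_eq`. -/
lemma IsRegular.energy_le (hφ : ContDiff ℝ 1 φ) (hu : IsSolution φ u)
    (hreg : IsRegular φ u) (hv : IsTruncatedSolution φ v) (h0 : v 0 = u 0)
    (hvu : range v ⊆ closure (range u)) (t : ℝ≥0) : φ (u t) ≤ φ (v t) := by
  by_contra! hlt
  obtain ⟨s, hs⟩ : ∃ s, φ (u s) < φ (u t) := by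
    by_contra! hc
    refine absurd hlt (not_lt.2 (energy_le_of_mem_closure hφ.continuous ?_ (hvu ⟨t, rfl⟩)))
    rintro _ ⟨s, rfl⟩
    exact hc s
  obtain ⟨e, he, het⟩ := exists_between (max_lt hs hlt)
  obtain ⟨w, hw, t', ht', hwt, hwv⟩ := hv.exists_isSolution t
  obtain ⟨q, hq, hqe⟩ := intermediate_value_Icc' (zero_le (a := t'))
    (hw.continuous_energy hφ).continuousOn (show e ∈ Icc (φ (w t')) (φ (w 0)) from
      ⟨by rw [hwt]; exact ((le_max_right _ _).trans_lt he).le, by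
        rw [hwv 0 zero_le, h0]
        exact het.le.trans (hu.antitone_energy hφ zero_le)⟩)
  change φ (w q) = e at hqe
  rw [hwv q hq.2] at hqe
  obtain ⟨p, hp⟩ := hu.mem_range_of_energy_lt hφ (hvu ⟨q, rfl⟩) (t := s)
    (by rw [hqe]; exact (le_max_left _ _).trans_lt he)
  have hpt : φ (u p) < φ (u t) := by rw [hp, hqe]; exact het
  have htp : t < p := by
    by_contra! hc
    exact absurd hpt (not_lt.2 (hu.antitone_energy hφ hc))
  have h1 := hreg.min_Tstar_le_of_eq hφ hu hv h0 hvu hp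
  have h2 : (t : ℝ≥0∞) < Tstar u :=
    (lt_Tstar_iff hu.continuous).2 ⟨p, htp, fun hc => by rw [hc] at hpt; exact hpt.false⟩
  have h3 := (lt_min (ENNReal.coe_lt_coe.2 htp) h2).trans_le h1
  exact absurd (hq.2.trans ht') (not_le.2 (ENNReal.coe_lt_coe.1 h3))

theorem isMinimal_iff_energy_le (hφ : ContDiff ℝ 1 φ) (hlb : HasQuadraticLowerBound φ)
    (hu : IsSolution φ u) : IsMinimal φ u ↔
      ∀ v, IsTruncatedSolution φ v → v 0 = u 0 → range v ⊆ closure (range u) →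
        ∀ t : ℝ≥0, φ (u t) ≤ φ (v t) := by
  rw [isMinimal_iff_isRegular hφ hlb hu]
  refine ⟨fun hreg v hv h0 hvu => hreg.energy_le hφ hu hv h0 hvu, fun h => ?_⟩
  obtain ⟨w, hw⟩ := hu.exists_isReduction hφ hlb
  have huw : u = w := by
    funext t
    rw [hw.eq_comp t]
    refine (hw.isSolution.eq_of_energy_le hφ (activeTime_le φ u t) ?_).symm
    rw [← hw.eq_comp]
    exact h w (Or.inl hw.isSolution) hw.zero_eq hw.range_subset t
  exact huw ▸ hw.isRegular hφ hu

lemma IsMinimal.eq_of_energy_le (hφ : ContDiff ℝ 1 φ) (hlb : HasQuadraticLowerBound φ)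
    (hu : IsMinimal φ u) (hv : IsTruncatedSolution φ v) (h0 : v 0 = u 0) (hvu : range v ⊆ range u)
    {t : ℝ≥0} (ht : φ (v t) ≤ φ (u t)) : v t = u t := by
  obtain ⟨s, hs⟩ := hvu ⟨t, rfl⟩
  have := (hu.isRegular hφ hlb).energy_le hφ hu.1 hv h0 (hvu.trans subset_closure) t
  rw [← hs]
  refine hu.1.eq_of_energy_eq hφ ?_
  rw [hs]
  exact le_antisymm ht this

lemma IsRegular.strictAntiOn_energy (hφ : ContDiff ℝ 1 φ) (hu : IsSolution φ u)
    (hreg : IsRegular φ u) :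
    StrictAntiOn (fun t : ℝ≥0 => φ (u t)) {t : ℝ≥0 | (t : ℝ≥0∞) < Tstar u} := by
  intro s hs t ht hst
  refine lt_of_not_ge fun hc => hst.ne ?_
  rw [← hreg s hs, ← hreg t ht]
  exact hu.activeTime_eq hφ (hu.eq_of_energy_le hφ hst.le hc).symm

lemma IsRegular.injOn (hφ : ContDiff ℝ 1 φ) (hu : IsSolution φ u) (hreg : IsRegular φ u) :
    InjOn u {t : ℝ≥0 | (t : ℝ≥0∞) < Tstar u} := fun _ hs _ ht h =>
  (hreg.strictAntiOn_energy hφ hu).injOn hs ht (congrArg φ h)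

end MinimalSolutions

lemma _root_.AbsolutelyContinuousOnInterval.congr {X : Type*} [PseudoMetricSpace X] {f g : ℝ → X}
    {a b : ℝ} (hf : AbsolutelyContinuousOnInterval f a b) (h : EqOn f g (uIcc a b)) :
    AbsolutelyContinuousOnInterval g a b := by
  rw [absolutelyContinuousOnInterval_iff] at hf ⊢
  intro ε hε
  obtain ⟨δ, hδ, H⟩ := hf ε hε
  refine ⟨δ, hδ, fun E hE hlen => ?_⟩
  rw [Finset.sum_congr rfl fun i hi => by rw [← h (hE.1 i hi).1, ← h (hE.1 i hi).2]]
  exact H E hE hlen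

section EnergyInterval

variable {E : Type*} {φ : E → ℝ} {u : ℝ≥0 → E}

lemma exists_energy_lt_of_mem_energyInterval {r : ℝ} (hr : r ∈ energyInterval φ u) :
    ∃ s, φ (u s) < r := by
  obtain ⟨s, hs⟩ := iInf_lt_iff.1 hr.1
  exact ⟨s, EReal.coe_lt_coe_iff.1 hs⟩

lemma ordConnected_energyInterval (φ : E → ℝ) (u : ℝ≥0 → E) :
    (energyInterval φ u).OrdConnected :=
  ⟨fun _ ha _ hb _ hc => ⟨ha.1.trans_le (EReal.coe_le_coe_iff.2 hc.1), hc.2.trans hb.2⟩⟩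

end EnergyInterval

/-! ### Time as a function of the energy. -/

section Time

variable {φ : H → ℝ} {u : ℝ≥0 → H}

lemma IsSolution.exists_of_mem_energyInterval (hφ : ContDiff ℝ 1 φ) (hu : IsSolution φ u) {r : ℝ}
    (hr : r ∈ energyInterval φ u) : ∃ t : ℝ≥0, (t : ℝ≥0∞) < Tstar u ∧ φ (u t) = r := by
  obtain ⟨s, hs⟩ := exists_energy_lt_of_mem_energyInterval hr
  obtain ⟨t, ht, rfl⟩ := intermediate_value_Icc' (zero_le (a := s))
    (hu.continuous_energy hφ).continuousOn ⟨hs.le, hr.2⟩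
  refine ⟨t, (lt_Tstar_iff hu.continuous).2 ⟨s, lt_of_le_of_ne ht.2 ?_, fun e => ?_⟩, rfl⟩
  · rintro rfl
    exact hs.false
  · simp only [e] at hs
    exact hs.false

lemma IsSolution.mem_energyInterval (hφ : ContDiff ℝ 1 φ) (hu : IsSolution φ u) {t : ℝ≥0}
    (ht : (t : ℝ≥0∞) < Tstar u) : φ (u t) ∈ energyInterval φ u := by
  obtain ⟨s, hs, hne⟩ := (lt_Tstar_iff hu.continuous).1 ht
  refine ⟨iInf_lt_iff.2 ⟨s, EReal.coe_lt_coe_iff.2 ?_⟩, hu.antitone_energy hφ zero_le⟩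
  exact lt_of_not_ge fun hc => hne (hu.eq_of_energy_le hφ hs.le hc)

lemma IsSolution.measurable_energy (hφ : ContDiff ℝ 1 φ) (hu : IsSolution φ u) :
    Measurable fun s : ℝ => φ (u s.toNNReal) :=
  ((hu.continuous_energy hφ).comp continuous_real_toNNReal).measurable

/-- The image under the energy of the Lebesgue measure on the active set is absolutely
continuous. -/
lemma IsSolution.map_energy_absolutelyContinuous (hφ : ContDiff ℝ 1 φ) (hu : IsSolution φ u)
    (T : ℝ) : (volume.restrict (activeSet φ u ∩ Icc 0 T)).map (fun s : ℝ => φ (u s.toNNReal)) ≪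
      (volume : Measure ℝ) := by
  have hm := hu.measurable_energy hφ
  refine Measure.AbsolutelyContinuous.mk fun B hB hB0 => ?_
  rw [Measure.map_apply hm hB, Measure.restrict_apply (hm hB)]
  set A := (fun s : ℝ => φ (u s.toNNReal)) ⁻¹' B ∩ (activeSet φ u ∩ Icc 0 T)
  have hA : MeasurableSet A :=
    (hm hB).inter ((isOpen_activeSet hφ hu).measurableSet.inter measurableSet_Icc)
  have h1 := lintegral_image_eq_lintegral_abs_deriv_mul hA
    (fun r hr => (hu.hasDerivWithinAt_energy hφ hr.2.2.1).mono fun a ha => ha.2.2.1)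
    ((hu.injOn_energy hφ).mono
      (inter_subset_right.trans (inter_subset_inter_right _ Icc_subset_Ici_self))) fun _ => 1
  rw [setLIntegral_one, measure_mono_null (image_subset_iff.2 inter_subset_left) hB0, eq_comm,
    lintegral_eq_zero_iff] at h1
  · rw [measure_eq_zero_iff_ae_notMem]
    filter_upwards [(ae_restrict_iff' hA).1 h1] with r hr hrA
    have h2 : ∇ φ (u r.toNNReal) ≠ 0 := hrA.2.1
    simpa [h2] using hr hrA
  · have h2 : Continuous fun r : ℝ => ∇ φ (u r.toNNReal) :=
      (continuous_gradient hφ).comp (hu.continuous.comp continuous_real_toNNReal)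
    exact ((h2.norm.pow 2).neg.abs.measurable.ennreal_ofReal).mul_const _

/-- Along a regular solution, time is a locally absolutely continuous function of the energy. -/
lemma IsRegular.exists_time (hφ : ContDiff ℝ 1 φ) (hu : IsSolution φ u) (hreg : IsRegular φ u) :
    ∃ ψ : ℝ → ℝ≥0, (∀ r ∈ energyInterval φ u, (ψ r : ℝ≥0∞) < Tstar u) ∧
      LocallyAbsolutelyContinuousOn (fun r => (ψ r : ℝ)) (energyInterval φ u) ∧
      ∀ t : ℝ≥0, (t : ℝ≥0∞) < Tstar u → t = ψ (φ (u t)) := by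
  have hex : ∀ r, ∃ t : ℝ≥0, r ∈ energyInterval φ u → (t : ℝ≥0∞) < Tstar u ∧ φ (u t) = r :=
    fun r => by
      by_cases hr : r ∈ energyInterval φ u
      · obtain ⟨t, ht⟩ := hu.exists_of_mem_energyInterval hφ hr
        exact ⟨t, fun _ => ht⟩
      · exact ⟨0, fun h => absurd h hr⟩
  choose ψ hψ using hex
  have hanti := hreg.strictAntiOn_energy hφ hu
  refine ⟨ψ, fun r hr => (hψ r hr).1, fun a b hab hI => ?_, fun t ht => ?_⟩
  swap
  · have := hψ _ (hu.mem_energyInterval hφ ht)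
    exact hanti.injOn ht this.1 this.2.symm
  have ha : a ∈ energyInterval φ u := hI ⟨le_rfl, hab⟩
  have hb : b ∈ energyInterval φ u := hI ⟨hab, le_rfl⟩
  set e : ℝ → ℝ := fun s => φ (u s.toNNReal)
  have he : Measurable e := hu.measurable_energy hφ
  set S := activeSet φ u ∩ Icc 0 (ψ a : ℝ)
  have hSfin : volume S ≠ ⊤ := measure_ne_top_of_subset inter_subset_right (by simp)
  have : IsFiniteMeasure (volume.restrict S) := isFiniteMeasure_restrict.2 hSfin
  set ν := (volume.restrict S).map e
  have hν : ν ≪ volume := hu.map_energy_absolutelyContinuous hφ _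
  set g : ℝ → ℝ := fun x => (ν.rnDeriv volume x).toReal
  have hg : Integrable g := Measure.integrable_toReal_rnDeriv
  have hval : ∀ r ∈ Icc a b, (ψ r : ℝ) = ∫ x in r..φ (u 0), g x := by
    intro r hr
    have hrI := hI hr
    rw [intervalIntegral.integral_of_le hrI.2, ← integral_Icc_eq_integral_Ioc,
      Measure.setIntegral_toReal_rnDeriv hν, measureReal_def, Measure.map_apply he measurableSet_Icc,
      Measure.restrict_apply (he measurableSet_Icc)]
    -- Energies above `r` are exactly those met up to time `ψ r`, so the `ν`-mass of `[r, φ (u 0)]`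
    -- is the active time there, which regularity identifies with `ψ r`.
    have hset : e ⁻¹' Icc r (φ (u 0)) ∩ S = activeSet φ u ∩ Icc 0 (ψ r : ℝ) := by
      obtain ⟨h1, h2⟩ := hψ r hrI
      obtain ⟨h3, h4⟩ := hψ a ha
      have hle : ψ r ≤ ψ a := by
        by_contra! hc
        have := hanti h3 h1 hc
        simp only [h2, h4] at this
        exact absurd this (not_lt.2 hr.1)
      ext s
      constructor
      · rintro ⟨⟨h5, -⟩, h6, h7, h8⟩
        refine ⟨h6, h7, ?_⟩
        by_contra! hc
        have hs : ((s.toNNReal : ℝ≥0) : ℝ≥0∞) < Tstar u :=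
          (ENNReal.coe_le_coe.2 (Real.toNNReal_le_iff_le_coe.2 h8)).trans_lt h3
        have := hanti h1 hs (Real.lt_toNNReal_iff_coe_lt.2 hc)
        simp only [h2] at this
        exact absurd h5 (not_le.2 this)
      · rintro ⟨h6, h7, h8⟩
        refine ⟨⟨?_, hu.antitone_energy hφ zero_le⟩, h6, h7, h8.trans (NNReal.coe_le_coe.2 hle)⟩
        rw [← h2]
        exact hu.antitone_energy hφ (Real.toNNReal_le_iff_le_coe.2 h8)
    rw [hset, ← coe_activeTime, hreg _ (hψ r hrI).1, ENNReal.coe_toReal]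
  have hAC := ((hg.intervalIntegrable (a := a) (b := φ (u 0)))
    |>.absolutelyContinuousOnInterval_intervalIntegral (c := φ (u 0)) right_mem_uIcc).neg.mono
      (c := a) (d := b) (by
        rw [uIcc_of_le hab, uIcc_of_le ha.2]
        exact Icc_subset_Icc_right hb.2)
  refine hAC.congr fun r hr => ?_
  rw [uIcc_of_le hab] at hr
  simp only [hval r hr, Pi.neg_apply, ← intervalIntegral.integral_symm]

/-- One-dimensional Sard: the energy has zero derivative at every critical time. -/
lemma IsSolution.volume_image_energy_eq_zero (hφ : ContDiff ℝ 1 φ) (hu : IsSolution φ u) :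
    volume ((fun s : ℝ => φ (u s.toNNReal)) '' (Ici 0 \ activeSet φ u)) = 0 := by
  refine addHaar_image_eq_zero_of_det_fderivWithin_eq_zero volume
    (f' := fun _ => ContinuousLinearMap.toSpanSingleton ℝ (0 : ℝ)) (fun r hr => ?_) fun r hr => ?_
  · have h1 := (hu.hasDerivWithinAt_energy hφ hr.1).mono
      (sdiff_subset (s := Ici 0) (t := activeSet φ u))
    have h2 : ∇ φ (u r.toNNReal) = 0 := by simpa [activeSet] using hr.2
    rw [h2] at h1
    simpa using h1.hasFDerivWithinAt
  · simp

/-- The elapsed time `t` is at most the integral of `|ψ'|` over the energies crossed. Critical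
energies are null, and pulling the rest back to the active set gives an integrand at most `1`, by
the chain rule for `ψ ∘ e = id`. -/
lemma IsSolution.isRegular_of_time (hφ : ContDiff ℝ 1 φ) (hu : IsSolution φ u) {ψ : ℝ → ℝ≥0}
    (hψ : LocallyAbsolutelyContinuousOn (fun r => (ψ r : ℝ)) (energyInterval φ u))
    (hψu : ∀ t : ℝ≥0, (t : ℝ≥0∞) < Tstar u → t = ψ (φ (u t))) : IsRegular φ u := by
  intro t ht
  refine le_antisymm (activeTime_le φ u t) ?_
  have h0 : ((0 : ℝ≥0) : ℝ≥0∞) < Tstar u := (ENNReal.coe_le_coe.2 zero_le).trans_lt ht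
  set Ψ : ℝ → ℝ := fun r => (ψ r : ℝ)
  set e : ℝ → ℝ := fun s => φ (u s.toNNReal) with he
  have hΨ : ∀ s : ℝ, 0 ≤ s → s ≤ t → Ψ (e s) = s := fun s hs hst => by
    have := hψu s.toNNReal
      ((ENNReal.coe_le_coe.2 (Real.toNNReal_le_iff_le_coe.2 hst)).trans_lt ht)
    simp only [Ψ, e, ← this, Real.coe_toNNReal s hs]
  have hab : φ (u t) ≤ φ (u 0) := hu.antitone_energy hφ zero_le
  have hAC := hψ _ _ hab ((ordConnected_energyInterval φ u).out (hu.mem_energyInterval hφ ht)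
    (hu.mem_energyInterval hφ h0))
  have hftc := hAC.integral_deriv_eq_sub
  set A := activeSet φ u ∩ Ioo 0 (t : ℝ)
  have hA : MeasurableSet A := (isOpen_activeSet hφ hu).measurableSet.inter measurableSet_Ioo
  have hΨ0 : Ψ (φ (u 0)) = 0 := by simpa [e] using hΨ 0 le_rfl t.2
  have hΨt : Ψ (φ (u t)) = t := by simpa [e] using hΨ t t.2 le_rfl
  rw [hΨ0, hΨt, intervalIntegral.integral_of_le hab, integral_Ioc_eq_integral_Ioo] at hftc
  have h1 : (t : ℝ≥0∞) ≤ ∫⁻ x in Ioo (φ (u t)) (φ (u 0)), ‖deriv Ψ x‖ₑ := by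
    have := enorm_integral_le_lintegral_enorm (μ := volume.restrict (Ioo (φ (u t)) (φ (u 0))))
      (deriv Ψ)
    rw [hftc, zero_sub, enorm_neg] at this
    simpa using this
  have hcov : Ioo (φ (u t)) (φ (u 0)) ⊆ e '' A ∪ e '' (Ici 0 \ activeSet φ u) := by
    have := intermediate_value_Ioo' (f := e) (NNReal.coe_nonneg t)
      ((hu.continuous_energy hφ).comp continuous_real_toNNReal).continuousOn
    simp only [he, Real.toNNReal_zero, Real.toNNReal_coe] at this
    intro x hx
    obtain ⟨s, hs, rfl⟩ := this hx
    by_cases hsA : s ∈ activeSet φ u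
    · exact Or.inl ⟨s, ⟨hsA, hs⟩, rfl⟩
    · exact Or.inr ⟨s, ⟨hs.1.le, hsA⟩, rfl⟩
  have h2 : ∫⁻ x in Ioo (φ (u t)) (φ (u 0)), ‖deriv Ψ x‖ₑ ≤ ∫⁻ x in e '' A, ‖deriv Ψ x‖ₑ := by
    refine (lintegral_mono_set hcov).trans ((lintegral_union_le _ _ _).trans ?_)
    rw [setLIntegral_measure_zero _ _ (hu.volume_image_energy_eq_zero hφ), add_zero]
  have h3 : ∫⁻ x in e '' A, ‖deriv Ψ x‖ₑ ≤ volume A := by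
    rw [lintegral_image_eq_lintegral_abs_deriv_mul hA
      (fun r hr => (hu.hasDerivWithinAt_energy hφ hr.2.1.le).mono fun a ha => ha.2.1.le)
      ((hu.injOn_energy hφ).mono (inter_subset_inter_right _
        (Ioo_subset_Icc_self.trans Icc_subset_Ici_self))), ← setLIntegral_one]
    refine setLIntegral_mono measurable_const fun r hr => ?_
    by_cases hd : DifferentiableAt ℝ Ψ (e r)
    · have he' := (hu.hasDerivWithinAt_energy hφ hr.2.1.le).hasDerivAt (Ici_mem_nhds hr.2.1)
      have hc := hd.hasDerivAt.comp r he'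
      have hid : HasDerivAt (Ψ ∘ e) 1 r := by
        refine (hasDerivAt_id r).congr_of_eventuallyEq ?_
        filter_upwards [Ioo_mem_nhds hr.2.1 hr.2.2] with s hs
        exact hΨ s hs.1.le hs.2.le
      rw [Real.enorm_eq_ofReal_abs, ← ENNReal.ofReal_mul (abs_nonneg _), ← abs_mul, mul_comm,
        hc.unique hid]
      simp
    -- Where `ψ` is not differentiable, `deriv` is `0` by convention, so the bound by `1` persists.
    · rw [deriv_zero_of_not_differentiableAt hd]
      simp
  rw [← ENNReal.coe_le_coe, coe_activeTime]
  exact h1.trans (h2.trans (h3.trans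
    (measure_mono (inter_subset_inter_right _ Ioo_subset_Icc_self))))

end Time

end GradientFlow

end

open GradientFlow in
theorem theorem3p3 {H : Type*} [NormedAddCommGroup H] [InnerProductSpace ℝ H] [CompleteSpace H]
    (φ : H → ℝ) (hφ : ContDiff ℝ 1 φ) (hlb : GradientFlow.HasQuadraticLowerBound φ) :
    -- the relation `≻` is a partial order on the set of solutions
    ((∀ u, GradientFlow.IsSolution φ u → GradientFlow.Succ u u) ∧
      (∀ u v w, GradientFlow.IsSolution φ u → GradientFlow.IsSolution φ v →
        GradientFlow.IsSolution φ w →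
        GradientFlow.Succ u v → GradientFlow.Succ v w → GradientFlow.Succ u w) ∧
      (∀ u v, GradientFlow.IsSolution φ u → GradientFlow.IsSolution φ v →
        GradientFlow.Succ u v → GradientFlow.Succ v u → u = v)) ∧
    -- (1)
    ((∀ R : Set H, (∃ y, GradientFlow.IsSolution φ y ∧ range y = R) →
        ∃ u, (GradientFlow.IsMinimal φ u ∧ R ⊆ range u ∧ range u ⊆ closure R) ∧
          (∀ u', GradientFlow.IsMinimal φ u' → R ⊆ range u' → range u' ⊆ closure R → u' = u) ∧
          (∀ v, GradientFlow.IsSolution φ v → R ⊆ range v → range v ⊆ closure R →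
            GradientFlow.Succ v u)) ∧
      (∀ v, GradientFlow.IsSolution φ v →
        ∃! u, GradientFlow.IsMinimal φ u ∧ GradientFlow.Succ v u)) ∧
    -- (2)
    (∀ u, GradientFlow.IsSolution φ u →
      (GradientFlow.IsMinimal φ u ↔
        ∀ v, GradientFlow.IsTruncatedSolution φ v → v 0 = u 0 → range v ⊆ closure (range u) →
          ∀ t₀ t₁ : ℝ≥0, u t₀ = v t₁ → min (t₀ : ℝ≥0∞) (GradientFlow.Tstar u) ≤ t₁)) ∧
    -- (3)
    (∀ u, GradientFlow.IsSolution φ u →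
      (GradientFlow.IsMinimal φ u ↔
        ∀ v, GradientFlow.IsTruncatedSolution φ v → v 0 = u 0 → range v ⊆ closure (range u) →
          ∀ t : ℝ≥0, φ (u t) ≤ φ (v t))) ∧
    -- (4)
    (∀ u v, GradientFlow.IsMinimal φ u → GradientFlow.IsTruncatedSolution φ v →
      v 0 = u 0 → range v ⊆ range u →
      (∀ t : ℝ≥0, (t : ℝ≥0∞) < GradientFlow.Tstar v → φ (v t) ≤ φ (u t)) →
      ∀ t : ℝ≥0, (t : ℝ≥0∞) < GradientFlow.Tstar v → v t = u t) ∧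
    -- (5)
    ((∀ u, GradientFlow.IsSolution φ u →
        (GradientFlow.IsMinimal φ u ↔
          (volume : Measure ℝ) ((fun t : ℝ≥0 => (t : ℝ)) ''
            {t : ℝ≥0 | (t : ℝ≥0∞) < GradientFlow.Tstar u ∧ ∇ φ (u t) = 0}) = 0)) ∧
      (∀ u, GradientFlow.IsMinimal φ u → 0 < GradientFlow.Tstar u →
        StrictAntiOn (fun t : ℝ≥0 => φ (u t)) {t : ℝ≥0 | (t : ℝ≥0∞) < GradientFlow.Tstar u} ∧
        InjOn u {t : ℝ≥0 | (t : ℝ≥0∞) < GradientFlow.Tstar u})) ∧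
    -- (6)
    (∀ u, GradientFlow.IsSolution φ u → (¬ ∃ c : H, ∀ t, u t = c) →
      (GradientFlow.IsMinimal φ u ↔
        ∃ ψ : ℝ → ℝ≥0,
          (∀ r ∈ GradientFlow.energyInterval φ u, (ψ r : ℝ≥0∞) < GradientFlow.Tstar u) ∧
          GradientFlow.LocallyAbsolutelyContinuousOn (fun r => (ψ r : ℝ))
            (GradientFlow.energyInterval φ u) ∧
          ∀ t : ℝ≥0, (t : ℝ≥0∞) < GradientFlow.Tstar u → t = ψ (φ (u t)))) := by
  refine ⟨⟨fun u _ => Succ.refl u, fun u v w _ _ _ => Succ.trans, fun u v hu hv =>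
    Succ.antisymm hφ hu hv⟩, ⟨?_, fun v hv => existsUnique_minimal_succ hφ hlb hv⟩,
    fun u hu => isMinimal_iff_min_Tstar_le hφ hlb hu,
    fun u hu => isMinimal_iff_energy_le hφ hlb hu,
    fun u v hu hv h0 hvu h t ht => hu.eq_of_energy_le hφ hlb hv h0 hvu (h t ht),
    ⟨fun u hu => (isMinimal_iff_isRegular hφ hlb hu).trans (isRegular_iff_volume_eq_zero hφ hu),
      fun u hu _ => ⟨(hu.isRegular hφ hlb).strictAntiOn_energy hφ hu.1,
        (hu.isRegular hφ hlb).injOn hφ hu.1⟩⟩, fun u hu _ => ?_⟩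
  · rintro R ⟨y, hy, rfl⟩
    exact existsUnique_minimal_of_range hφ hlb hy
  · rw [isMinimal_iff_isRegular hφ hlb hu]
    exact ⟨fun h => h.exists_time hφ hu, fun ⟨ψ, _, h1, h2⟩ => hu.isRegular_of_time hφ h1 h2⟩
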